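/- Let $n\ge 3$ and let $M$ be a closed, connected, oriented smooth $(n+1)$-manifold with a fixed spin structure $\sigma$ (a two-sheeted covering of the bundle of oriented frames of $TM$ which over every point of $M$ restricts to the universal covering of the fibre $\cong \mathrm{GL}^+(n+1,\mathbb R)$). A framing is a homotopy class of trivializations. Let $\Omega_1^{\mathrm{fr}}(M)$ be the set of bordism classes $[C,\varphi_C]$ of closed $1$-dimensional submanifolds $C\subset M$ with a framing $\varphi_C$ of the normal bundle $\nu(C)$; here $(C_0,\varphi_0)$ and $(C_1,\varphi_1)$ are framed bordant if there is a compact surface $\Sigma\subset M\times[0,1]$ with $\partial\Sigma = C_0\times\{0\}\cup C_1\times\{1\}$ and a framing of the normal bundle of $\Sigma$ which restricts to $\varphi_i$ on $C_i$. A stable framing of a manifold $C$ is a trivialization of $TC\oplus\varepsilon^l$ for some $l$, up to stabilization and homotopy, and $\Omega_1^{\mathrm{fr}}$ is the set of bordism classes of stably framed closed $1$-manifolds (the bordism surface carries a stable framing of its tangent bundle which restricts to the given ones on the boundary). For a normally framed closed $1$-dimensional submanifold $(C,\varphi_C)$ of $M$, the spin structure determines a framing of $TM|_C$, represented by any trivialization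 of $TM|_C$ by oriented frames that lifts to $\sigma$. Together with $\varphi_C$ it gives, through $$\varepsilon^{n+1}\cong TM|_C\cong TC\oplus\nu(C)\cong TC\oplus\varepsilon^n,$$ a stable framing $\varphi_{\mathrm{st}}$ of $TC$. Proposition. The stable framing $\varphi_{\mathrm{st}}$ exists and is uniquely determined by $(C,\varphi_C)$ and $\sigma$, and the class $[C,\varphi_{\mathrm{st}}]\in\Omega_1^{\mathrm{fr}}$ depends only on the framed bordism class $[C,\varphi_C]\in\Omega_1^{\mathrm{fr}}(M)$: if $[C,\varphi_C]=[C',\varphi_{C'}]$ in $\Omega_1^{\mathrm{fr}}(M)$, then $[C,\varphi_{\mathrm{st}}]=[C',\varphi'_{\mathrm{st}}]$ in $\Omega_1^{\mathrm{fr}}$. Hence there is exactly one map $\kappa\colon\Omega_1^{\mathrm{fr}}(M)\to\Omega_1^{\mathrm{fr}}$ (the degree map of $M$ with respect to $\sigma$) with $\kappa([C,\varphi_C])=[C,\varphi_{\mathrm{st}}]$ for all normally framed closed $1$-dimensional submanifolds $(C,\varphi_C)$ of $M$. -/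

import Mathlib

open scoped Manifold ContDiff Topology
open Manifold

universe u

/-! ### Closed 1-manifolds and bordisms between them -/

/-- A closed smooth 1-manifold (possibly disconnected, possibly empty). -/
structure ClosedOneManifold : Type (u + 1) where
  carrier : Type u
  [topologicalSpace : TopologicalSpace carrier]
  [chartedSpace : ChartedSpace (EuclideanSpace ℝ (Fin 1)) carrier]
  [isManifold : IsManifold (𝓡 1) ∞ carrier]
  [compactSpace : CompactSpace carrier]
  [t2Space : T2Space carrier]

attribute [instance] ClosedOneManifold.topologicalSpace ClosedOneManifold.chartedSpace
  ClosedOneManifold.isManifold ClosedOneManifold.compactSpace ClosedOneManifold.t2Space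

/-- A bordism from `C₀` to `C₁`: a compact smooth surface `W` with boundary, whose boundary is
identified with the disjoint union of `C₀` and `C₁`. -/
structure Bordism (C₀ C₁ : ClosedOneManifold.{u}) : Type (u + 1) where
  W : Type u
  [topologicalSpace : TopologicalSpace W]
  [chartedSpace : ChartedSpace (EuclideanHalfSpace 2) W]
  [isManifold : IsManifold (𝓡∂ 2) ∞ W]
  [compactSpace : CompactSpace W]
  [t2Space : T2Space W]
  /-- the inclusion of the incoming boundary -/
  b₀ : C₀.carrier → W
  /-- the inclusion of the outgoing boundary -/
  b₁ : C₁.carrier → W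
  isSmoothEmbedding_b₀ : IsSmoothEmbedding (𝓡 1) (𝓡∂ 2) ∞ b₀
  isSmoothEmbedding_b₁ : IsSmoothEmbedding (𝓡 1) (𝓡∂ 2) ∞ b₁
  disjoint_range : Disjoint (Set.range b₀) (Set.range b₁)
  boundary_eq : (𝓡∂ 2).boundary W = Set.range b₀ ∪ Set.range b₁

attribute [instance] Bordism.topologicalSpace Bordism.chartedSpace Bordism.isManifold
  Bordism.compactSpace Bordism.t2Space

/-! ### Stable framings -/

section StableFraming

variable {E H : Type*} [NormedAddCommGroup E] [NormedSpace ℝ E] [TopologicalSpace H]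
  (I : ModelWithCorners ℝ E H)
  (S : Type*) [TopologicalSpace S] [ChartedSpace H S] [IsManifold I 1 S]

/-- For a `d`-dimensional manifold `S`, a trivialization of `TS ⊕ ε^l`: `l + d` continuous sections
which are linearly independent, hence (their number being the rank) a basis, at every point. -/
structure StableTriv (d l : ℕ) where
  vec : Fin (l + d) → ∀ x : S, TangentSpace I x × (Fin l → ℝ)
  continuous_fst : ∀ i, Continuous fun x => (⟨x, (vec i x).1⟩ : TangentBundle I S)
  continuous_snd : ∀ i, Continuous fun x => (vec i x).2
  linearIndependent : ∀ x, LinearIndependent ℝ fun i => vec i x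

variable {I S}

/-- Homotopy of trivializations of `TS ⊕ ε^l`, through trivializations. -/
def StableTriv.Homotopic {d l : ℕ} (s s' : StableTriv I S d l) : Prop :=
  ∃ K : unitInterval → StableTriv I S d l,
    (∀ i, Continuous fun p : unitInterval × S =>
      (⟨p.2, ((K p.1).vec i p.2).1⟩ : TangentBundle I S)) ∧
    (∀ i, Continuous fun p : unitInterval × S => ((K p.1).vec i p.2).2) ∧
    K 0 = s ∧ K 1 = s'

/-- The trivialization `s ⊕ id` of `(TS ⊕ ε^l) ⊕ ε^(L - l) = TS ⊕ ε^L`. -/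
noncomputable def StableTriv.stabilize {d l L : ℕ} (s : StableTriv I S d l) (hL : l ≤ L) :
    StableTriv I S d L where
  vec j x :=
    if h : (j : ℕ) < l + d then
      ((s.vec ⟨j, h⟩ x).1, fun k => if hk : (k : ℕ) < l then (s.vec ⟨j, h⟩ x).2 ⟨k, hk⟩ else 0)
    else (0, Pi.single ⟨(j : ℕ) - d, by omega⟩ 1)
  continuous_fst j := by
    by_cases h : (j : ℕ) < l + d
    · simpa [h] using s.continuous_fst ⟨j, h⟩
    · simp only [h, dite_false]
      exact Bundle.Trivialization.continuous_zeroSection ℝ (F := E)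
        (E := (TangentSpace I : S → Type _))
  continuous_snd j := by
    by_cases h : (j : ℕ) < l + d
    · simp only [h, dite_true]
      refine continuous_pi fun k => ?_
      by_cases hk : (k : ℕ) < l
      · simpa [hk] using (continuous_pi_iff.1 (s.continuous_snd ⟨j, h⟩)) ⟨k, hk⟩
      · simpa [hk] using continuous_const
    · simpa [h] using continuous_const
  linearIndependent x := by
    have hs := s.linearIndependent x
    rw [Fintype.linearIndependent_iff] at hs ⊢
    intro c hc
    have h2 : ∀ j : Fin (L + d), ¬ (j : ℕ) < l + d → c j = 0 := by
      intro j hj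
      have h := congrFun (congrArg Prod.snd hc) ⟨(j : ℕ) - d, by omega⟩
      rw [Prod.snd_sum, Finset.sum_apply, Finset.sum_eq_single j] at h
      · simpa [hj] using h
      · intro i _ hij
        by_cases hi : (i : ℕ) < l + d
        · have : ¬ ((j : ℕ) - d < l) := by omega
          simp [hi, this]
        · have : (j : ℕ) - d ≠ (i : ℕ) - d := fun h => hij (Fin.ext (by omega))
          simp [hi, this]
      · simp
    have h1 := hs (fun i => c (Fin.castLE (by omega) i)) (by
      rw [Fintype.sum_of_injective (Fin.castLE (by omega : l + d ≤ L + d))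
        (Fin.castLE_injective _) _
        (fun j => c j • if h : (j : ℕ) < l + d then s.vec ⟨j, h⟩ x else 0)]
      · ext1
        · have h := congrArg Prod.fst hc
          rw [Prod.fst_sum] at h ⊢
          refine Eq.trans (Finset.sum_congr rfl fun j _ => ?_) h
          by_cases hj : (j : ℕ) < l + d <;> simp [hj]
        · ext k
          have h := congrFun (congrArg Prod.snd hc) (Fin.castLE hL k)
          rw [Prod.snd_sum, Finset.sum_apply] at h ⊢
          refine Eq.trans (Finset.sum_congr rfl fun j _ => ?_) h
          by_cases hj : (j : ℕ) < l + d
          · simp [hj]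
          · simp [h2 j hj]
      · intro j hj
        have : ¬ (j : ℕ) < l + d := fun h => hj ⟨⟨j, h⟩, rfl⟩
        simp [h2 j this]
      · intro i
        simp)
    intro j
    by_cases hj : (j : ℕ) < l + d
    · exact h1 ⟨j, hj⟩
    · exact h2 j hj

variable (I S) in
/-- A stable framing of `TS`: an equivalence class of trivializations of the bundles `TS ⊕ ε^l`,
`l ∈ ℕ`, where two of them are identified if they become homotopic after stabilization. -/
def StableFraming (d : ℕ) :=
  Quot fun s s' : Σ l, StableTriv I S d l =>
    ∃ (L : ℕ) (h : s.1 ≤ L) (h' : s'.1 ≤ L),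
      StableTriv.Homotopic (s.2.stabilize h) (s'.2.stabilize h')

/-- The stable framing represented by a trivialization of `TS ⊕ ε^l`. -/
def StableTriv.framing {d l : ℕ} (s : StableTriv I S d l) : StableFraming I S d :=
  Quot.mk _ ⟨l, s⟩

end StableFraming

/-! ### The bordism set `Ω₁^fr` of stably framed closed 1-manifolds -/

/-- A stably (tangentially) framed closed 1-manifold. -/
structure StablyFramedOneManifold : Type (u + 1) where
  C : ClosedOneManifold.{u}
  framing : StableFraming (𝓡 1) C.carrier 1

/-- The component transverse to the boundary of a tangent vector `v` of a surface at a point `p`,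
computed in the chart at `p` with values in the half plane `{y | 0 ≤ y 0}`. At a boundary point `v`
points inward if it is positive and outward if it is negative; this is independent of the chart. -/
noncomputable def inwardComponent {W : Type*} [TopologicalSpace W]
    [ChartedSpace (EuclideanHalfSpace 2) W] (p : W) (v : TangentSpace (𝓡∂ 2) p) : ℝ :=
  let w : EuclideanSpace ℝ (Fin 2) :=
    mfderiv (𝓡∂ 2) 𝓘(ℝ, EuclideanSpace ℝ (Fin 2)) (extChartAt (𝓡∂ 2) p) p v
  w 0

/-- Let `b : C → W` parametrize boundary components of the surface `W`, let `ψ` be a trivialization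
of `TW ⊕ ε^l` and let `N` be a vector field along `b` transverse to the boundary. Then `N` gives
`b^*TW ⊕ ε^l ≅ (TC ⊕ ℝ N) ⊕ ε^l ≅ TC ⊕ ε^(l+1)`, and `s` is the trivialization of `TC ⊕ ε^(l+1)`
corresponding to the restriction of `ψ`. The last coordinate of `ε^(l+1)` is the one of `N`. -/
def IsBoundaryRestriction {C W : Type*} [TopologicalSpace C]
    [ChartedSpace (EuclideanSpace ℝ (Fin 1)) C] [IsManifold (𝓡 1) 1 C] [TopologicalSpace W]
    [ChartedSpace (EuclideanHalfSpace 2) W] [IsManifold (𝓡∂ 2) 1 W] (b : C → W)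
    (N : ∀ x, TangentSpace (𝓡∂ 2) (b x)) {l : ℕ} (ψ : StableTriv (𝓡∂ 2) W 2 l)
    (s : StableTriv (𝓡 1) C 1 (l + 1)) : Prop :=
  ∀ (i : Fin (l + 2)) (x : C),
    ψ.vec i (b x) =
      (mfderiv (𝓡 1) (𝓡∂ 2) b x (s.vec i x).1 + (s.vec i x).2 (Fin.last l) • N x,
        fun k => (s.vec i x).2 k.castSucc)

/-- Stably framed bordism: a bordism `W` with a stable framing of `TW` which restricts to the given
stable framings. The normal line of the boundary is trivialized in the direction from `C₀` to `C₁`: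
by inward vectors on `C₀` and by outward vectors on `C₁`. -/
def StablyFramedBordant (X Y : StablyFramedOneManifold.{u}) : Prop :=
  ∃ (B : Bordism X.C Y.C) (l : ℕ) (ψ : StableTriv (𝓡∂ 2) B.W 2 l),
    (∃ (N : ∀ x, TangentSpace (𝓡∂ 2) (B.b₀ x)) (s : StableTriv (𝓡 1) X.C.carrier 1 (l + 1)),
      Continuous (fun x => (⟨B.b₀ x, N x⟩ : TangentBundle (𝓡∂ 2) B.W)) ∧
      (∀ x, 0 < inwardComponent (B.b₀ x) (N x)) ∧
      IsBoundaryRestriction B.b₀ N ψ s ∧ s.framing = X.framing) ∧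
    (∃ (N : ∀ x, TangentSpace (𝓡∂ 2) (B.b₁ x)) (s : StableTriv (𝓡 1) Y.C.carrier 1 (l + 1)),
      Continuous (fun x => (⟨B.b₁ x, N x⟩ : TangentBundle (𝓡∂ 2) B.W)) ∧
      (∀ x, inwardComponent (B.b₁ x) (N x) < 0) ∧
      IsBoundaryRestriction B.b₁ N ψ s ∧ s.framing = Y.framing)

/-- `Ω₁^fr`, the set of bordism classes of stably framed closed 1-manifolds. -/
def StableOmegaOne : Type (u + 1) := Quot StablyFramedBordant.{u}

/-- The class `[C, Φ] ∈ Ω₁^fr`. -/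
def StableOmegaOne.mk (C : ClosedOneManifold.{u}) (Φ : StableFraming (𝓡 1) C.carrier 1) :
    StableOmegaOne.{u} :=
  Quot.mk _ ⟨C, Φ⟩

/-! ### Normal framings -/

section NormalFraming

variable {E H E' H' : Type*} [NormedAddCommGroup E] [NormedSpace ℝ E] [TopologicalSpace H]
  (I : ModelWithCorners ℝ E H)
  [NormedAddCommGroup E'] [NormedSpace ℝ E'] [TopologicalSpace H']
  (J : ModelWithCorners ℝ E' H')
  {S X : Type*} [TopologicalSpace S] [ChartedSpace H S]
  [TopologicalSpace X] [ChartedSpace H' X] [IsManifold J 1 X]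

/-- A trivialization of the normal bundle `g^*TX / TS` of an embedding `g : S → X` of codimension
`r`, given by representatives: `r` continuous vector fields along `g` which are linearly
independent, hence (their number being the rank) a basis, modulo `TS` at every point. -/
structure NormalTriv (g : S → X) (r : ℕ) where
  vec : Fin r → ∀ x : S, TangentSpace J (g x)
  continuous_vec : ∀ j, Continuous fun x => (⟨g x, vec j x⟩ : TangentBundle J X)
  linearIndependent : ∀ x, LinearIndependent ℝ fun j =>
    (LinearMap.range (mfderiv I J g x).toLinearMap).mkQ (vec j x)

variable {I J}

/-- Homotopy of normal trivializations, through normal trivializations. -/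
def NormalTriv.Homotopic {g : S → X} {r : ℕ} (ν ν' : NormalTriv I J g r) : Prop :=
  ∃ K : unitInterval → NormalTriv I J g r,
    (∀ j, Continuous fun p : unitInterval × S =>
      (⟨g p.2, (K p.1).vec j p.2⟩ : TangentBundle J X)) ∧
    K 0 = ν ∧ K 1 = ν'

variable (I J) in
/-- A normal framing: a homotopy class of trivializations of the normal bundle. -/
def NormalFraming (g : S → X) (r : ℕ) :=
  Quot (NormalTriv.Homotopic (I := I) (J := J) (g := g) (r := r))

/-- The normal framing represented by a normal trivialization. -/
def NormalTriv.framing {g : S → X} {r : ℕ} (ν : NormalTriv I J g r) : NormalFraming I J g r :=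
  Quot.mk _ ν

end NormalFraming

/-! ### The bordism set `Ω₁^fr(M)` of normally framed closed 1-submanifolds -/

section Ambient

variable {n : ℕ} (M : Type u) [TopologicalSpace M]
  [ChartedSpace (EuclideanSpace ℝ (Fin (n + 1))) M] [IsManifold (𝓡 (n + 1)) ∞ M]

/-- A normally framed closed 1-dimensional submanifold of the `(n+1)`-manifold `M`. -/
structure NormallyFramedSubmanifold : Type (u + 1) where
  C : ClosedOneManifold.{u}
  emb : C.carrier → M
  isSmoothEmbedding_emb : IsSmoothEmbedding (𝓡 1) (𝓡 (n + 1)) ∞ emb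
  framing : NormalFraming (𝓡 1) (𝓡 (n + 1)) emb n

variable {M}

/-- Let `F : W → M × ℝ` parametrize a surface, and let `b : C → W` parametrize boundary components
with `F ∘ b = (ι, t)`. Under the isomorphism `ι^*TM / TC ≅ b^*(F^*T(M × ℝ) / TW)` induced by the
inclusion `M = M × {t} → M × ℝ`, the restriction of the normal trivialization `ν` to `C`
is the normal trivialization `ν₀`. -/
def IsNormalRestriction {C W : Type u} [TopologicalSpace C]
    [ChartedSpace (EuclideanSpace ℝ (Fin 1)) C] [TopologicalSpace W]
    [ChartedSpace (EuclideanHalfSpace 2) W] (ι : C → M) (t : ℝ) (b : C → W) (F : W → M × ℝ)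
    (ν : NormalTriv (𝓡∂ 2) ((𝓡 (n + 1)).prod 𝓘(ℝ, ℝ)) F n)
    (ν₀ : NormalTriv (𝓡 1) (𝓡 (n + 1)) ι n) : Prop :=
  ∀ (j : Fin n) (x : C), ∃ v : TangentSpace (𝓡∂ 2) (b x),
    (⟨F (b x), ν.vec j (b x) + mfderiv (𝓡∂ 2) ((𝓡 (n + 1)).prod 𝓘(ℝ, ℝ)) F (b x) v⟩ :
      TangentBundle ((𝓡 (n + 1)).prod 𝓘(ℝ, ℝ)) (M × ℝ)) =
    tangentMap (𝓡 (n + 1)) ((𝓡 (n + 1)).prod 𝓘(ℝ, ℝ)) (fun p : M => (p, t)) ⟨ι x, ν₀.vec j x⟩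

/-- Framed bordism: a compact surface `Σ ⊆ M × [0,1]` (the image of the embedding `F`)
with `∂Σ = C₀ × {0} ∪ C₁ × {1}` and with a normal framing which restricts to the normal framings
of `C₀` and `C₁`. The last condition forces `Σ` to be transverse to `M × {0}` along `C₀` and
to `M × {1}` along `C₁`. -/
def FramedBordant (X Y : NormallyFramedSubmanifold (n := n) M) : Prop :=
  ∃ (B : Bordism X.C Y.C) (F : B.W → M × ℝ)
    (ν : NormalTriv (𝓡∂ 2) ((𝓡 (n + 1)).prod 𝓘(ℝ, ℝ)) F n),
    IsSmoothEmbedding (𝓡∂ 2) ((𝓡 (n + 1)).prod 𝓘(ℝ, ℝ)) ∞ F ∧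
    (∀ w, (F w).2 ∈ Set.Icc (0 : ℝ) 1) ∧
    (∀ x, F (B.b₀ x) = (X.emb x, 0)) ∧
    (∀ x, F (B.b₁ x) = (Y.emb x, 1)) ∧
    (∃ ν₀, IsNormalRestriction X.emb 0 B.b₀ F ν ν₀ ∧ ν₀.framing = X.framing) ∧
    (∃ ν₁, IsNormalRestriction Y.emb 1 B.b₁ F ν ν₁ ∧ ν₁.framing = Y.framing)

variable (M) in
/-- `Ω₁^fr(M)`, the set of bordism classes of normally framed closed 1-submanifolds of `M`. -/
def OmegaOne : Type (u + 1) := Quot (FramedBordant (n := n) (M := M))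

/-- The class `[C, φ] ∈ Ω₁^fr(M)`. -/
def NormallyFramedSubmanifold.bordismClass (X : NormallyFramedSubmanifold (n := n) M) :
    OmegaOne (n := n) M :=
  Quot.mk _ X

/-! ### Orientations and spin structures -/

variable (M) in
/-- The frame bundle of `M`. -/
def FrameBundle : Type u :=
  Σ x : M, Module.Basis (Fin (n + 1)) ℝ (TangentSpace (𝓡 (n + 1)) x)

/-- The frame bundle has the topology of a subspace of the `(n+1)`-fold power of `TM`. -/
noncomputable instance : TopologicalSpace (FrameBundle (n := n) M) :=
  TopologicalSpace.induced
    (fun f (i : Fin (n + 1)) => (⟨f.1, f.2 i⟩ : TangentBundle (𝓡 (n + 1)) M)) inferInstance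

variable (n M) in
/-- An orientation of `M`: a choice of orientations of the tangent spaces which is continuous, in the
sense that the positively oriented frames are an open set of frames. -/
structure TangentOrientation where
  orientation : ∀ x : M, Orientation ℝ (TangentSpace (𝓡 (n + 1)) x) (Fin (n + 1))
  isOpen_positive :
    IsOpen {f : FrameBundle (n := n) M | f.2.orientation = orientation f.1}

/-- The bundle of positively oriented frames. -/
def TangentOrientation.Frames (o : TangentOrientation n M) : Type u :=
  {f : FrameBundle (n := n) M // f.2.orientation = o.orientation f.1}

noncomputable instance (o : TangentOrientation n M) : TopologicalSpace o.Frames :=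
  instTopologicalSpaceSubtype

/-- A spin structure on the oriented manifold `M` of dimension `n + 1 ≥ 3`: a two-sheeted covering of
the bundle of positively oriented frames which over every `x : M` restricts to the universal covering
of the frames at `x`, that is to the covering `Spin → SO` up to homotopy. -/
structure SpinStructure (o : TangentOrientation n M) : Type (u + 1) where
  P : Type u
  [topologicalSpace : TopologicalSpace P]
  proj : P → o.Frames
  isCoveringMap : IsCoveringMap proj
  twoSheeted : ∀ f, (proj ⁻¹' {f}).ncard = 2
  simplyConnected : ∀ x : M, SimplyConnectedSpace {p : P // (proj p).1.1 = x}

attribute [instance] SpinStructure.topologicalSpace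

/-- `Φ` is the stable tangential framing `φ_st` of `C`, given by
`ε^(n+1) ≅ TM|_C ≅ TC ⊕ ν(C) ≅ TC ⊕ ε^n`. Here `q` is a section over `C` of the spin structure, the
frames `proj (q x)` trivialize `TM|_C` (this is the framing induced by the spin structure),
`ν` is a trivialization of `ν(C)` in the given framing, and the trivialization `s`
of `TC ⊕ ε^n` is mapped by `(v, a) ↦ dι(v) + ∑ a_j ν_j` to these frames. -/
def IsInducedStableFraming {o : TangentOrientation n M} (σ : SpinStructure o)
    (X : NormallyFramedSubmanifold (n := n) M) (Φ : StableFraming (𝓡 1) X.C.carrier 1) : Prop :=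
  ∃ (q : X.C.carrier → σ.P) (ν : NormalTriv (𝓡 1) (𝓡 (n + 1)) X.emb n)
    (s : StableTriv (𝓡 1) X.C.carrier 1 n),
    Continuous q ∧ ν.framing = X.framing ∧ s.framing = Φ ∧
    ∀ (i : Fin (n + 1)) (x : X.C.carrier),
      (⟨X.emb x, mfderiv (𝓡 1) (𝓡 (n + 1)) X.emb x (s.vec i x).1 +
          ∑ j, (s.vec i x).2 j • ν.vec j x⟩ : TangentBundle (𝓡 (n + 1)) M) =
        ⟨(σ.proj (q x)).1.1, (σ.proj (q x)).1.2 i⟩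

end Ambient

/-! The composite of the covering `σ.proj` with the projection of frames to `M` has simply connected
fibres. Hence there is no obstruction to sections along maps from compact spaces of dimension at
most two: over a curve `C` a section exists, any two are joined by a section over `[0,1] × C`, and
over a bordism surface a section exists as well. This is
`HasSimplyConnectedLocalModels.exists_lift`, applied through
`SpinStructure.hasSimplyConnectedLocalModels`.

A section supplies a frame of `TM` along the submanifold. The linear isomorphism `(v, a) ↦ dg(v) + ∑
a_j ν_j` (`NormalTriv.splitting`) pulls this frame back to a trivialization of `TC ⊕ ε^n`. The
inverse isomorphisms depend continuously on parameters, so homotopies of the section and of the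
normal trivialization yield homotopies of the result. This gives existence and uniqueness of the
induced stable framing (`exists_isInducedStableFraming`, `IsInducedStableFraming.unique`).

For a framed bordism `W → M × ℝ`, take a section over `W` and complete its frame by the unit field
`∂_t` to a frame of `T(M × ℝ)`. Together with the normal framing of `W` it gives a trivialization of
`TW ⊕ ε^n`. Along the boundary two deformations compare it with the induced framing
(`exists_isBoundaryRestriction`): the normal fields of `W` are moved to those of `C`, then a field
tangent to `W` and transverse to `C` is moved to `∂_t`. That field has height derivative one; since
the height is minimal on the incoming end and maximal on the outgoing end, it points inward on the
first and outward on the second, as a bordism requires. Thus bordant submanifolds have bordant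
induced framings (`FramedBordant.stablyFramedBordant`), and the degree map is obtained by descending
to the quotient. -/

/-! ### Extending maps from subsets of a square into a simply connected space -/

section SquareFilling

open unitInterval

variable {F : Type*} [TopologicalSpace F]

/-- In a simply connected space a map defined on the four edges of a square extends to the
square. -/
theorem SimplyConnectedSpace.exists_square_filling [SimplyConnectedSpace F] {a b c d : F}
    (bot : Path a b) (right : Path b d) (left : Path a c) (top : Path c d) :
    ∃ K : C(I × I, F), (∀ x, K (x, 0) = bot x) ∧ (∀ x, K (x, 1) = top x) ∧
      (∀ y, K (0, y) = left y) ∧ (∀ y, K (1, y) = right y) := by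
  obtain ⟨G⟩ := SimplyConnectedSpace.paths_homotopic (bot.trans right) (left.trans top)
  have key : ∀ s u : I, (0 : ℝ) ≤ max 0 (2 * (u : ℝ) - 1) + s * min (2 * (u : ℝ)) (2 - 2 * u) ∧
      max 0 (2 * (u : ℝ) - 1) + s * min (2 * (u : ℝ)) (2 - 2 * u) ≤ 1 := by
    intro s u
    have hs0 := s.2.1; have hs1 := s.2.2; have hu0 := u.2.1; have hu1 := u.2.2
    rcases le_total (u : ℝ) (1 / 2) with h | h
    · rw [max_eq_left (by linarith), min_eq_left (by linarith)]
      constructor <;> nlinarith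
    · rw [max_eq_right (by linarith), min_eq_right (by linarith)]
      constructor <;> nlinarith
  -- With `m = max 0 (2u - 1)` and `w = min (2u) (2 - 2u)`, this is `(m + (1 - s) w, m + s w)`. It
  -- sweeps the antidiagonal `x + y = 2u`; `s = 0` runs along the bottom and right edges, `s = 1`
  -- along the left and top edges.
  let q : I × I → I × I := fun p =>
    (⟨_, key (σ p.1) p.2⟩, ⟨_, key p.1 p.2⟩)
  have hq : Continuous q := by
    unfold q
    fun_prop
  have hsurj : Function.Surjective q := by
    rintro ⟨x, y⟩
    have hx0 := x.2.1; have hx1 := x.2.2; have hy0 := y.2.1; have hy1 := y.2.2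
    have hu : ((x : ℝ) + y) / 2 ∈ Set.Icc (0 : ℝ) 1 := ⟨by linarith, by linarith⟩
    set w : ℝ := min ((x : ℝ) + y) (2 - (x + y)) with hw
    set m : ℝ := max 0 ((x : ℝ) + y - 1) with hm
    have h1 : 0 ≤ (y : ℝ) - m := by
      rw [hm]; rcases le_total (0 : ℝ) (x + y - 1) with h | h
      · rw [max_eq_right h]; linarith
      · rw [max_eq_left h]; linarith
    have hxw : (x : ℝ) + y = w + 2 * m := by
      rw [hm, hw]; rcases le_total (0 : ℝ) (x + y - 1) with h | h
      · rw [max_eq_right h, min_eq_right (by linarith)]; ring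
      · rw [max_eq_left h, min_eq_left (by linarith)]; ring
    have h2 : 0 ≤ (x : ℝ) - m := by
      rw [hm]; rcases le_total (0 : ℝ) (x + y - 1) with h | h
      · rw [max_eq_right h]; linarith
      · rw [max_eq_left h]; linarith
    have hw0 : 0 ≤ w := by linarith
    have hs : ((y : ℝ) - m) / w ∈ Set.Icc (0 : ℝ) 1 :=
      ⟨div_nonneg h1 hw0, div_le_one_of_le₀ (by linarith) hw0⟩
    have hsw : ((y : ℝ) - m) / w * w = y - m := by
      rcases eq_or_ne w 0 with h | h
      · rw [h]; linarith
      · field_simp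
    refine ⟨(⟨_, hs⟩, ⟨_, hu⟩), ?_⟩
    have e1 : 2 * (((x : ℝ) + y) / 2) = x + y := by ring
    have e2 : 2 - 2 * (((x : ℝ) + y) / 2) = 2 - (x + y) := by ring
    unfold q
    ext
    · simp only [e1, unitInterval.coe_symm_eq, ← hw, ← hm]
      linarith
    · simp only [e1, ← hw, ← hm]
      linarith
  have hQ : Topology.IsQuotientMap q :=
    (hq.isClosedMap).isQuotientMap hq hsurj
  -- The only identifications made by `q` occur where `w = 0`, that is at `u = 0` and `u = 1`. There
  -- the homotopy does not depend on `s`, because it fixes endpoints.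
  have hfac : Function.FactorsThrough (G : C(I × I, F)) q := by
    rintro ⟨s, u⟩ ⟨s', u'⟩ h
    have hs0 := s.2.1; have hs1 := s.2.2; have hu0 := u.2.1; have hu1 := u.2.2
    have hu0' := u'.2.1; have hu1' := u'.2.2
    have h1 := congrArg (fun p : I × I => (p.1 : ℝ)) h
    have h2 := congrArg (fun p : I × I => (p.2 : ℝ)) h
    simp only [q, unitInterval.coe_symm_eq] at h1 h2
    have hsum : ∀ u : ℝ, 2 * max 0 (2 * u - 1) + min (2 * u) (2 - 2 * u) = 2 * u := by
      intro u
      rcases le_total u (1 / 2) with h | h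
      · rw [max_eq_left (by linarith), min_eq_left (by linarith)]; ring
      · rw [max_eq_right (by linarith), min_eq_right (by linarith)]; ring
    have huu : u = u' := by
      ext; linarith [hsum u, hsum u']
    subst huu
    rcases eq_or_ne (min (2 * (u : ℝ)) (2 - 2 * u)) 0 with hz | hz
    · rcases min_choice (2 * (u : ℝ)) (2 - 2 * u) with h | h
      · have : u = 0 := by ext; simp only [Set.Icc.coe_zero]; linarith
        subst this
        simp
      · have : u = 1 := by ext; simp only [Set.Icc.coe_one]; linarith
        subst this
        simp
    · have : s = s' := by
        ext
        exact mul_right_cancel₀ hz (by linarith)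
      rw [this]
  have hQ' : Topology.IsQuotientMap (⟨q, hq⟩ : C(I × I, I × I)) := hQ
  let K := hQ'.lift (G : C(I × I, F)) hfac
  have hK : ∀ p, K (q p) = G p := fun p => congrFun (congrArg DFunLike.coe (hQ'.lift_comp _ hfac)) p
  have half : ∀ x : I, (x : ℝ) / 2 ∈ Set.Icc (0 : ℝ) 1 := fun x =>
    ⟨by linarith [x.2.1], by linarith [x.2.2]⟩
  have half' : ∀ x : I, (1 + (x : ℝ)) / 2 ∈ Set.Icc (0 : ℝ) 1 := fun x =>
    ⟨by linarith [x.2.1], by linarith [x.2.2]⟩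
  have tr1 : ∀ {x y z : F} (p : Path x y) (p' : Path y z) (t : I),
      p.trans p' ⟨(t : ℝ) / 2, half t⟩ = p t := by
    intro x y z p p' t
    rw [Path.trans_apply, dif_pos (show (t : ℝ) / 2 ≤ 1 / 2 by linarith [t.2.2])]
    congr 1; ext; simp only []; ring
  have tr2 : ∀ {x y z : F} (p : Path x y) (p' : Path y z) (t : I),
      p.trans p' ⟨(1 + (t : ℝ)) / 2, half' t⟩ = p' t := by
    intro x y z p p' t
    rw [Path.trans_apply]
    split_ifs with h
    · have : t = 0 := by
        ext; simp only [Set.Icc.coe_zero]; simp only [] at h; linarith [t.2.1]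
      subst this
      simp
    · congr 1; ext; simp only []; ring
  have m1 : ∀ x : I, max (0 : ℝ) (2 * ((x : ℝ) / 2) - 1) = 0 := fun x =>
    max_eq_left (by linarith [x.2.2])
  have m2 : ∀ x : I, min (2 * ((x : ℝ) / 2)) (2 - 2 * ((x : ℝ) / 2)) = x := fun x => by
    rw [min_eq_left (by linarith [x.2.2])]; ring
  have m3 : ∀ x : I, max (0 : ℝ) (2 * ((1 + (x : ℝ)) / 2) - 1) = x := fun x => by
    rw [max_eq_right (by linarith [x.2.1])]; ring
  have m4 : ∀ x : I, min (2 * ((1 + (x : ℝ)) / 2)) (2 - 2 * ((1 + (x : ℝ)) / 2)) = 1 - x :=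
    fun x => by rw [min_eq_right (by linarith [x.2.1])]; ring
  refine ⟨K, fun x => ?_, fun x => ?_, fun y => ?_, fun y => ?_⟩
  · have : q (0, ⟨_, half x⟩) = (x, 0) := by
      ext <;> simp [q, m1, m2]
    rw [← this, hK, G.apply_zero]
    exact tr1 _ _ _
  · have : q (1, ⟨_, half' x⟩) = (x, 1) := by
      ext <;> simp [q, m3, m4]
    rw [← this, hK, G.apply_one]
    exact tr2 _ _ _
  · have : q (1, ⟨_, half y⟩) = (0, y) := by
      ext <;> simp [q, m1, m2]
    rw [← this, hK, G.apply_one]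
    exact tr1 _ _ _
  · have : q (0, ⟨_, half' y⟩) = (1, y) := by
      ext <;> simp [q, m3, m4]
    rw [← this, hK, G.apply_zero]
    exact tr2 _ _ _

/-- Functions on the strips `[k, k + 1] × Z` which agree on the common boundaries
glue to a continuous function. -/
theorem continuous_floor_glue {Z : Type*} [TopologicalSpace Z] (G : ℤ → ℝ × Z → F)
    (hG : ∀ k, Continuous (G k))
    (h : ∀ (k : ℤ) (z : Z), G k ((k : ℝ) + 1, z) = G (k + 1) ((k : ℝ) + 1, z)) :
    Continuous fun p : ℝ × Z => G ⌊p.1⌋ p := by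
  -- At the right end of a strip the floor already selects the next function; the matching
  -- hypothesis makes this harmless, so each closed strip sees a single continuous function.
  have hEq : ∀ (k : ℤ) (p : ℝ × Z), p.1 ∈ Set.Icc (k : ℝ) (k + 1) → G ⌊p.1⌋ p = G k p := by
    rintro k ⟨x, z⟩ ⟨h1, h2⟩
    rcases h2.lt_or_eq with h3 | h3
    · rw [show ⌊x⌋ = k from Int.floor_eq_iff.2 ⟨h1, h3⟩]
    · have : ⌊x⌋ = k + 1 := Int.floor_eq_iff.2
        ⟨by push_cast; exact h3.ge, by push_cast; dsimp at h3; linarith⟩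
      dsimp only at h3 ⊢
      rw [this, h3, h]
  have hlf : LocallyFinite fun k : ℤ => {p : ℝ × Z | p.1 ∈ Set.Icc (k : ℝ) (k + 1)} :=
    by
    refine LocallyFinite.preimage_continuous (g := (Prod.fst : ℝ × Z → ℝ))
      (f := fun k : ℤ => Set.Icc (k : ℝ) (k + 1)) ?_ continuous_fst
    intro x
    refine ⟨Set.Ioo (x - 1) (x + 1), Ioo_mem_nhds (by linarith) (by linarith),
      (Set.finite_Icc ⌊x - 2⌋ ⌈x + 2⌉).subset ?_⟩
    rintro k ⟨y, ⟨h1, h2⟩, h3, h4⟩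
    have h5 := Int.floor_le (x - 2)
    have h6 := Int.le_ceil (x + 2)
    constructor
    · have : ((⌊x - 2⌋ : ℤ) : ℝ) ≤ (k : ℝ) := by linarith
      exact_mod_cast this
    · have : (k : ℝ) ≤ ((⌈x + 2⌉ : ℤ) : ℝ) := by linarith
      exact_mod_cast this
  refine hlf.continuous ?_ (fun k => ?_) fun k => ?_
  · refine Set.eq_univ_of_forall fun p => Set.mem_iUnion.2 ⟨⌊p.1⌋, Int.floor_le _, ?_⟩
    exact (Int.lt_floor_add_one _).le
  · exact isClosed_Icc.preimage continuous_fst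
  · exact (hG k).continuousOn.congr fun p hp => hEq k p hp

/-- The closed unit square with lower left corner `(i, j)`. -/
def unitCell (i j : ℤ) : Set (ℝ × ℝ) := Set.Icc (i : ℝ) (i + 1) ×ˢ Set.Icc (j : ℝ) (j + 1)

/-- A map from an open subset of the plane to a simply connected space agrees, on all the squares
of the integer grid contained in this subset, with a map defined on the plane. -/
theorem SimplyConnectedSpace.exists_extension_from_cells [SimplyConnectedSpace F] {O : Set (ℝ × ℝ)}
    (f : ℝ × ℝ → F) (hf : ContinuousOn f O) :
    ∃ g : ℝ × ℝ → F, Continuous g ∧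
      ∀ i j : ℤ, unitCell i j ⊆ O → Set.EqOn g f (unitCell i j) := by
  classical
  -- horizontal and vertical edges
  have hor : ∀ i j : ℤ, ∃ p : Path (f ((i : ℝ), (j : ℝ))) (f (((i + 1 : ℤ) : ℝ), (j : ℝ))),
      Set.Icc (i : ℝ) (i + 1) ×ˢ {(j : ℝ)} ⊆ O → ∀ s : I, p s = f ((i : ℝ) + s, (j : ℝ)) := by
    intro i j
    by_cases h : Set.Icc (i : ℝ) (i + 1) ×ˢ {(j : ℝ)} ⊆ O
    · refine ⟨⟨⟨fun s : I => f ((i : ℝ) + s, (j : ℝ)), ?_⟩, ?_, ?_⟩, fun _ s => rfl⟩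
      · refine hf.comp_continuous (by fun_prop) fun s => h ⟨?_, rfl⟩
        exact ⟨by linarith [s.2.1], by linarith [s.2.2]⟩
      · simp
      · simp
    -- `f` is total, so its values at the vertices are available even off `O`, and any path between
    -- them will do.
    · exact ⟨PathConnectedSpace.somePath _ _, fun h' => absurd h' h⟩
  have ver : ∀ i j : ℤ, ∃ p : Path (f ((i : ℝ), (j : ℝ))) (f ((i : ℝ), ((j + 1 : ℤ) : ℝ))),
      {(i : ℝ)} ×ˢ Set.Icc (j : ℝ) (j + 1) ⊆ O → ∀ s : I, p s = f ((i : ℝ), (j : ℝ) + s) := by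
    intro i j
    by_cases h : {(i : ℝ)} ×ˢ Set.Icc (j : ℝ) (j + 1) ⊆ O
    · refine ⟨⟨⟨fun s : I => f ((i : ℝ), (j : ℝ) + s), ?_⟩, ?_, ?_⟩, fun _ s => rfl⟩
      · refine hf.comp_continuous (by fun_prop) fun s => h ⟨rfl, ?_⟩
        exact ⟨by linarith [s.2.1], by linarith [s.2.2]⟩
      · simp
      · simp
    · exact ⟨PathConnectedSpace.somePath _ _, fun h' => absurd h' h⟩
  choose H hH using hor
  choose V hV using ver
  -- Cells inside `O` copy `f`; the others are filled in from their four edges. Either way the edges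
  -- carry the same `H` and `V`, so neighbouring cells fit together.
  have cell : ∀ i j : ℤ, ∃ K : C(I × I, F), (∀ x, K (x, 0) = H i j x) ∧
      (∀ x, K (x, 1) = H i (j + 1) x) ∧ (∀ y, K (0, y) = V i j y) ∧
      (∀ y, K (1, y) = V (i + 1) j y) ∧
      (unitCell i j ⊆ O → ∀ p : I × I, K p = f ((i : ℝ) + p.1, (j : ℝ) + p.2)) := by
    intro i j
    by_cases h : unitCell i j ⊆ O
    · have e1 := hH i j fun p hp => h ⟨hp.1, by rw [hp.2]; constructor <;> linarith⟩
      have e2 := hH i (j + 1) fun p hp => h ⟨hp.1, by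
        rw [hp.2]; push_cast; constructor <;> linarith⟩
      have e3 := hV i j fun p hp => h ⟨by rw [hp.1]; constructor <;> linarith, hp.2⟩
      have e4 := hV (i + 1) j fun p hp => h ⟨by
        rw [hp.1]; push_cast; constructor <;> linarith, hp.2⟩
      refine ⟨⟨fun p => f ((i : ℝ) + p.1, (j : ℝ) + p.2), ?_⟩, fun x => ?_, fun x => ?_,
        fun y => ?_, fun y => ?_, fun _ p => rfl⟩
      · refine hf.comp_continuous (by fun_prop) fun p => h ⟨?_, ?_⟩
        · exact ⟨by linarith [p.1.2.1], by linarith [p.1.2.2]⟩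
        · exact ⟨by linarith [p.2.2.1], by linarith [p.2.2.2]⟩
      · rw [e1]; simp
      · rw [e2]; simp
      · rw [e3]; simp
      · rw [e4]; simp
    · obtain ⟨K, h1, h2, h3, h4⟩ := SimplyConnectedSpace.exists_square_filling
        (H i j) (V (i + 1) j) (V i j) (H i (j + 1))
      exact ⟨K, h1, h2, h3, h4, fun h' => absurd h' h⟩
  choose K hK0 hK1 hKl hKr hKO using cell
  let pr : ℝ → I := Set.projIcc 0 1 zero_le_one
  have hpr : Continuous pr := continuous_projIcc
  have pr0 : pr 0 = 0 := Set.projIcc_left ..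
  have pr1 : pr 1 = 1 := Set.projIcc_right ..
  let G : ℤ → ℤ → ℝ × ℝ → F := fun i j p => K i j (pr (p.1 - i), pr (p.2 - j))
  have hG : ∀ i j, Continuous (G i j) := fun i j => by unfold G; fun_prop
  have hrow : ∀ i, Continuous fun p : ℝ × ℝ => G i ⌊p.2⌋ p := by
    intro i
    have := continuous_floor_glue (fun j (p : ℝ × ℝ) => G i j p.swap)
      (fun j => (hG i j).comp continuous_swap) (by
        intro j z
        simp only [G, Prod.swap_prod_mk, Int.cast_add, Int.cast_one, sub_self, add_sub_cancel_left,
          pr0, pr1, hK0, hK1])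
    exact this.comp continuous_swap
  refine ⟨fun p => G ⌊p.1⌋ ⌊p.2⌋ p, continuous_floor_glue (fun i p => G i ⌊p.2⌋ p) hrow ?_, ?_⟩
  · intro i z
    simp only [G, Int.cast_add, Int.cast_one, sub_self, add_sub_cancel_left, pr0, pr1, hKl, hKr]
  · intro i j hij
    -- on the cell `(i, j)` the glued function is `G i j`
    have hcell : ∀ (i j : ℤ) (x y : ℝ), x ∈ Set.Icc (i : ℝ) (i + 1) → y ∈ Set.Icc (j : ℝ) (j + 1) →
        G ⌊x⌋ ⌊y⌋ (x, y) = G i j (x, y) := by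
      have step1 : ∀ (i j : ℤ) (x y : ℝ), x ∈ Set.Icc (i : ℝ) (i + 1) →
          G ⌊x⌋ j (x, y) = G i j (x, y) := by
        rintro i j x y ⟨h1, h2⟩
        rcases h2.lt_or_eq with h3 | h3
        · rw [show ⌊x⌋ = i from Int.floor_eq_iff.2 ⟨h1, h3⟩]
        · rw [show ⌊x⌋ = i + 1 from Int.floor_eq_iff.2 ⟨by push_cast; exact h3.ge, by
            push_cast; linarith⟩, h3]
          simp only [G, Int.cast_add, Int.cast_one, sub_self, add_sub_cancel_left, pr0, pr1,
            hKl, hKr]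
      have step2 : ∀ (i j : ℤ) (x y : ℝ), y ∈ Set.Icc (j : ℝ) (j + 1) →
          G i ⌊y⌋ (x, y) = G i j (x, y) := by
        rintro i j x y ⟨h1, h2⟩
        rcases h2.lt_or_eq with h3 | h3
        · rw [show ⌊y⌋ = j from Int.floor_eq_iff.2 ⟨h1, h3⟩]
        · rw [show ⌊y⌋ = j + 1 from Int.floor_eq_iff.2 ⟨by push_cast; exact h3.ge, by
            push_cast; linarith⟩, h3]
          simp only [G, Int.cast_add, Int.cast_one, sub_self, add_sub_cancel_left, pr0, pr1,
            hK0, hK1]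
      intro i j x y hx hy
      rw [step1 i _ x y hx, step2 i j x y hy]
    rintro ⟨x, y⟩ ⟨hx, hy⟩
    change G ⌊x⌋ ⌊y⌋ (x, y) = f (x, y)
    rw [hcell i j x y hx hy]
    have hx' : x - i ∈ Set.Icc (0 : ℝ) 1 := ⟨by linarith [hx.1], by linarith [hx.2]⟩
    have hy' : y - j ∈ Set.Icc (0 : ℝ) 1 := ⟨by linarith [hy.1], by linarith [hy.2]⟩
    simp only [G, hKO i j hij, pr, Set.projIcc_of_mem _ hx', Set.projIcc_of_mem _ hy']
    simp

/-- A map from a neighbourhood of a closed subset `A` of the unit square to a simply connected space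
agrees on `A` with a map defined on the square. -/
theorem SimplyConnectedSpace.exists_extension_square [SimplyConnectedSpace F] {O A : Set (I × I)}
    (hO : IsOpen O) (hA : IsClosed A) (hAO : A ⊆ O) (f : I × I → F) (hf : ContinuousOn f O) :
    ∃ g : C(I × I, F), Set.EqOn g f A := by
  -- Choose a mesh finer than the distance from `A` to the complement of `O`: after rescaling by `M
  -- = m + 1`, every grid cell meeting `A` stays inside `O`.
  obtain ⟨δ, hδ, hthick⟩ := hA.isCompact.exists_thickening_subset_open hO hAO
  obtain ⟨m, hm⟩ := exists_nat_one_div_lt hδ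
  let pr : ℝ → I := Set.projIcc 0 1 zero_le_one
  have hpr : Continuous pr := continuous_projIcc
  set M : ℝ := (m : ℝ) + 1 with hM
  have hM0 : 0 < M := by positivity
  -- Clamping makes `f ∘ r` defined on the whole plane, so cells that protrude beyond the rescaled
  -- square need no special treatment.
  let r : ℝ × ℝ → I × I := fun p => (pr (p.1 / M), pr (p.2 / M))
  have hr : Continuous r := by unfold r; fun_prop
  obtain ⟨g, hg, hgf⟩ := SimplyConnectedSpace.exists_extension_from_cells (O := r ⁻¹' O) (f ∘ r)
    (hf.comp hr.continuousOn fun p hp => hp)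
  refine ⟨⟨fun p => g (M * p.1, M * p.2), by fun_prop⟩, fun p hp => ?_⟩
  have hrp : r (M * p.1, M * p.2) = p := by
    simp only [r, pr, mul_div_cancel_left₀ _ hM0.ne', Set.projIcc_val]
  have hmem : ∀ x : ℝ, x ∈ Set.Icc ((⌊x⌋ : ℤ) : ℝ) (⌊x⌋ + 1) := fun x =>
    ⟨Int.floor_le x, (Int.lt_floor_add_one x).le⟩
  have hp' : ((M * p.1, M * p.2) : ℝ × ℝ) ∈ unitCell ⌊M * (p.1 : ℝ)⌋ ⌊M * (p.2 : ℝ)⌋ :=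
    ⟨hmem _, hmem _⟩
  change g (M * p.1, M * p.2) = f p
  rw [hgf _ _ ?_ hp', Function.comp_apply, hrp]
  rintro ⟨x, y⟩ ⟨hx, hy⟩
  apply hthick
  refine Metric.mem_thickening_iff.2 ⟨p, hp, ?_⟩
  rw [← hrp]
  have hd : ∀ (k : ℤ) (a b : ℝ), a ∈ Set.Icc (k : ℝ) (k + 1) → b ∈ Set.Icc (k : ℝ) (k + 1) →
      dist (pr (a / M)) (pr (b / M)) < δ := by
    intro k a b ha hb
    refine lt_of_le_of_lt ?_ hm
    refine (Set.abs_projIcc_sub_projIcc zero_le_one).trans ?_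
    rw [← sub_div, abs_div, abs_of_pos hM0]
    gcongr
    rw [abs_le]
    constructor <;> linarith [ha.1, ha.2, hb.1, hb.2]
  exact max_lt (hd _ _ _ hx hp'.1) (hd _ _ _ hy hp'.2)

end SquareFilling

/-! ### Lifting maps from compact surfaces through projections with simply connected local models -/

section Sections

open unitInterval

/-- Every point of `X` has arbitrarily small neighbourhoods which are images of injective continuous
maps defined on `K`. -/
def HasNhdsOfShape (K X : Type*) [TopologicalSpace K] [TopologicalSpace X] : Prop :=
  ∀ x : X, ∀ V ∈ 𝓝 x, ∃ φ : K → X, Continuous φ ∧ Function.Injective φ ∧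
    Set.range φ ∈ 𝓝 x ∧ Set.range φ ⊆ V

/-- Every point has arbitrarily small neighbourhoods homeomorphic to the closed unit square. -/
abbrev HasSquareNhds (X : Type*) [TopologicalSpace X] : Prop := HasNhdsOfShape (I × I) X

theorem HasNhdsOfShape.prod {K L X Y : Type*} [TopologicalSpace K] [TopologicalSpace X]
    [TopologicalSpace L] [TopologicalSpace Y] (hX : HasNhdsOfShape K X)
    (hY : HasNhdsOfShape L Y) : HasNhdsOfShape (K × L) (X × Y) := by
  rintro ⟨x, y⟩ V hV
  obtain ⟨U, hU, W, hW, hUW⟩ := mem_nhds_prod_iff.1 hV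
  obtain ⟨φ, h1, h2, h3, h4⟩ := hX x U hU
  obtain ⟨ψ, k1, k2, k3, k4⟩ := hY y W hW
  refine ⟨Prod.map φ ψ, h1.prodMap k1, h2.prodMap k2, ?_, ?_⟩
  · rw [Set.range_prodMap]
    exact prod_mem_nhds h3 k3
  · rw [Set.range_prodMap]
    exact (Set.prod_mono h4 k4).trans hUW

theorem HasNhdsOfShape.of_charts {K H X : Type*} [TopologicalSpace K] [TopologicalSpace H]
    [TopologicalSpace X] (hH : HasNhdsOfShape K H)
    (e : X → OpenPartialHomeomorph X H) (he : ∀ x, x ∈ (e x).source) : HasNhdsOfShape K X := by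
  intro x V hV
  have h1 : (e x).target ∩ (e x).symm ⁻¹' V ∈ 𝓝 (e x x) := by
    refine Filter.inter_mem ((e x).open_target.mem_nhds ((e x).map_source (he x))) ?_
    refine (e x).continuousAt_symm ((e x).map_source (he x)) ?_
    rwa [(e x).left_inv (he x)]
  obtain ⟨φ, h2, h3, h4, h5⟩ := hH _ _ h1
  have h6 : ∀ k, φ k ∈ (e x).target := fun k => (h5 ⟨k, rfl⟩).1
  refine ⟨(e x).symm ∘ φ, (e x).continuousOn_symm.comp_continuous h2 h6, fun a b hab => ?_, ?_, ?_⟩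
  · exact h3 ((e x).symm.injOn (h6 a) (h6 b) hab)
  · have h7 := (e x).symm.image_mem_nhds ((e x).map_source (he x)) h4
    rwa [(e x).left_inv (he x), ← Set.range_comp] at h7
  · rintro _ ⟨k, rfl⟩
    exact (h5 ⟨k, rfl⟩).2

theorem HasNhdsOfShape.of_homeomorph {K H X : Type*} [TopologicalSpace K] [TopologicalSpace H]
    [TopologicalSpace X] (hH : HasNhdsOfShape K H) (e : X ≃ₜ H) : HasNhdsOfShape K X :=
  hH.of_charts (fun _ => e.toOpenPartialHomeomorph) fun _ => trivial

/-- Every point of a nondegenerate real interval has arbitrarily small closed intervals as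
neighbourhoods. -/
theorem hasNhdsOfShape_interval {s : Set ℝ} (hs : s.OrdConnected) (hs' : s.Nontrivial) :
    HasNhdsOfShape I s := by
  rintro ⟨x, hx⟩ V hV
  obtain ⟨ε, hε, hball⟩ := Metric.mem_nhds_iff.1 hV
  -- The endpoint `a` lies strictly left of `x` unless `x` is the least element of `s`; the last
  -- clause records this, so that `[a, b]` is a neighbourhood of `x` within `s` also at an end.
  obtain ⟨a, ha, hax, haε, ha'⟩ : ∃ a ∈ s, a ≤ x ∧ x - ε < a ∧ (a = x → ∀ z ∈ s, x ≤ z) := by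
    by_cases h : ∃ z ∈ s, z < x
    · obtain ⟨z, hz, hzx⟩ := h
      refine ⟨max z (x - ε / 2), hs.out hz hx ⟨le_max_left _ _, max_le hzx.le (by linarith)⟩,
        max_le hzx.le (by linarith), lt_max_of_lt_right (by linarith), fun h => ?_⟩
      exact absurd h (max_lt hzx (by linarith)).ne
    · push Not at h
      exact ⟨x, hx, le_rfl, by linarith, fun _ => h⟩
  obtain ⟨b, hb, hbx, hbε, hb'⟩ : ∃ b ∈ s, x ≤ b ∧ b < x + ε ∧ (b = x → ∀ z ∈ s, z ≤ x) := by
    by_cases h : ∃ z ∈ s, x < z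
    · obtain ⟨z, hz, hzx⟩ := h
      refine ⟨min z (x + ε / 2), hs.out hx hz ⟨le_min hzx.le (by linarith), min_le_left _ _⟩,
        le_min hzx.le (by linarith), min_lt_of_right_lt (by linarith), fun h => ?_⟩
      exact absurd h (lt_min hzx (by linarith)).ne'
    · push Not at h
      exact ⟨x, hx, le_rfl, by linarith, fun _ => h⟩
  have hab : a < b := by
    refine lt_of_le_of_ne (hax.trans hbx) fun h => ?_
    have h1 : a = x := le_antisymm hax (h ▸ hbx)
    obtain ⟨z, hz, hzx⟩ := hs'.exists_ne x
    exact hzx (le_antisymm (hb' (h ▸ h1) z hz) (ha' h1 z hz))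
  have hmem : ∀ t : I, a + t * (b - a) ∈ Set.Icc a b := fun t =>
    ⟨by nlinarith [t.2.1], by nlinarith [t.2.2]⟩
  refine ⟨fun t => ⟨a + t * (b - a), hs.out ha hb (hmem t)⟩, by fun_prop, fun t t' h => ?_, ?_, ?_⟩
  · have h1 : a + t * (b - a) = a + t' * (b - a) := congrArg Subtype.val h
    exact Subtype.ext (mul_right_cancel₀ (sub_pos.2 hab).ne' (add_left_cancel h1))
  · obtain ⟨δ, hδ, hδa, hδb⟩ : ∃ δ > 0, (a = x ∨ δ ≤ x - a) ∧ (b = x ∨ δ ≤ b - x) := by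
      rcases hax.eq_or_lt with h | h <;> rcases hbx.eq_or_lt with h' | h'
      · exact ⟨1, one_pos, Or.inl h, Or.inl h'.symm⟩
      · exact ⟨b - x, by linarith, Or.inl h, Or.inr le_rfl⟩
      · exact ⟨x - a, by linarith, Or.inr le_rfl, Or.inl h'.symm⟩
      · exact ⟨min (x - a) (b - x), lt_min (by linarith) (by linarith),
          Or.inr (min_le_left _ _), Or.inr (min_le_right _ _)⟩
    refine Metric.mem_nhds_iff.2 ⟨δ, hδ, ?_⟩
    rintro ⟨z, hz⟩ hzx
    have h1 : |z - x| < δ := hzx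
    rw [abs_lt] at h1
    have haz : a ≤ z := by
      rcases hδa with h | h
      · rw [h]; exact ha' h z hz
      · linarith
    have hzb : z ≤ b := by
      rcases hδb with h | h
      · rw [h]; exact hb' h z hz
      · linarith
    refine ⟨⟨(z - a) / (b - a), div_nonneg (by linarith) (by linarith),
      div_le_one_of_le₀ (by linarith) (by linarith)⟩, Subtype.ext ?_⟩
    change a + (z - a) / (b - a) * (b - a) = z
    rw [div_mul_cancel₀ _ (sub_pos.2 hab).ne']
    ring
  · rintro _ ⟨t, rfl⟩
    apply hball
    change |a + t * (b - a) - x| < ε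
    rw [abs_lt]
    constructor <;> linarith [(hmem t).1, (hmem t).2]

theorem hasNhdsOfShape_real : HasNhdsOfShape I ℝ :=
  (hasNhdsOfShape_interval Set.ordConnected_univ Set.nontrivial_univ).of_homeomorph
    (Homeomorph.Set.univ ℝ).symm

theorem hasNhdsOfShape_oneManifold (X : Type*) [TopologicalSpace X]
    [ChartedSpace (EuclideanSpace ℝ (Fin 1)) X] : HasNhdsOfShape I X := by
  refine HasNhdsOfShape.of_charts (H := EuclideanSpace ℝ (Fin 1)) ?_
    (chartAt (EuclideanSpace ℝ (Fin 1))) (mem_chart_source _)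
  exact hasNhdsOfShape_real.of_homeomorph
    ((EuclideanSpace.equiv (Fin 1) ℝ).toHomeomorph.trans (Homeomorph.funUnique (Fin 1) ℝ))

theorem hasSquareNhds_cylinder (X : Type*) [TopologicalSpace X]
    [ChartedSpace (EuclideanSpace ℝ (Fin 1)) X] : HasSquareNhds (I × X) :=
  (hasNhdsOfShape_interval Set.ordConnected_Icc
    ⟨0, ⟨le_rfl, zero_le_one⟩, 1, ⟨zero_le_one, le_rfl⟩, zero_ne_one⟩).prod (hasNhdsOfShape_oneManifold X)

theorem hasSquareNhds_surface (X : Type*) [TopologicalSpace X]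
    [ChartedSpace (EuclideanHalfSpace 2) X] : HasSquareNhds X := by
  refine HasNhdsOfShape.of_charts (H := EuclideanHalfSpace 2) ?_
    (chartAt (EuclideanHalfSpace 2)) (mem_chart_source _)
  refine HasNhdsOfShape.of_homeomorph ((hasNhdsOfShape_interval (s := Set.Ici (0 : ℝ))
    Set.ordConnected_Ici ⟨0, Set.self_mem_Ici, 1, zero_le_one' ℝ, zero_ne_one⟩).prod
    hasNhdsOfShape_real)
    { toFun := fun z => (⟨z.1 0, z.2⟩, z.1 1)
      invFun := fun p => ⟨!₂[p.1.1, p.2], p.1.2⟩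
      left_inv := fun z => by
        refine Subtype.ext ?_
        ext i
        fin_cases i <;> rfl
      right_inv := fun p => rfl
      continuous_toFun := by
        refine Continuous.prodMk (Continuous.subtype_mk ?_ _) ?_
        · exact (EuclideanSpace.proj (𝕜 := ℝ) (0 : Fin 2)).continuous.comp continuous_subtype_val
        · exact (EuclideanSpace.proj (𝕜 := ℝ) (1 : Fin 2)).continuous.comp continuous_subtype_val
      continuous_invFun := by
        refine Continuous.subtype_mk ?_ _
        refine (PiLp.continuous_toLp 2 _).comp (continuous_pi fun i => ?_)
        fin_cases i
        · exact continuous_subtype_val.comp continuous_fst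
        · exact continuous_snd }

/-- Locally over the base, `π` is a retract, over the base, of the projection of a product with
simply connected fibre. For instance `π` may be a fibre bundle with simply connected fibre. -/
def HasSimplyConnectedLocalModels {P M : Type u} [TopologicalSpace P] [TopologicalSpace M]
    (π : P → M) : Prop :=
  ∀ m, ∃ U ∈ 𝓝 m, ∃ (F : Type u) (_ : TopologicalSpace F) (_ : SimplyConnectedSpace F)
    (a : P → F) (Ψ : M → F → P), ContinuousOn a (π ⁻¹' U) ∧
    ContinuousOn (Function.uncurry Ψ) (U ×ˢ Set.univ) ∧ (∀ u ∈ U, ∀ p, π (Ψ u p) = u) ∧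
    ∀ q, π q ∈ U → Ψ (π q) (a q) = q

variable {P M : Type u} [TopologicalSpace P] [TopologicalSpace M] {π : P → M}
  {X : Type*} [TopologicalSpace X] [CompactSpace X] [T2Space X]

/-- The induction step of the lifting theorem. Over a small square a lift is encoded by a map to the
simply connected fibre, which extends by `SimplyConnectedSpace.exists_extension_square`, and the
retraction turns the extension back into a lift. The neighbourhood `S` is chosen before `A` and `f`,
which is what lets the steps be chained. -/
theorem HasSimplyConnectedLocalModels.exists_local_extension
    (hπ : HasSimplyConnectedLocalModels π) (hX : HasSquareNhds X) {g : X → M}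
    (hg : Continuous g) (x : X) :
    ∃ S ∈ 𝓝 x, ∀ (A O : Set X) (f : X → P), IsClosed A → IsOpen O → A ⊆ O → ContinuousOn f O →
      (∀ x ∈ O, π (f x) = g x) →
      ∃ (A' O' : Set X) (f' : X → P), IsClosed A' ∧ IsOpen O' ∧ A' ⊆ O' ∧ ContinuousOn f' O' ∧
        (∀ x ∈ O', π (f' x) = g x) ∧ A ∪ S ⊆ A' ∧ Set.EqOn f' f A := by
  classical
  obtain ⟨U, hU, F, _, _, a, Ψ, ha, hΨ, hΨπ, hΨa⟩ := hπ (g x)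
  obtain ⟨φ, hφ, hφinj, hφx, hφU⟩ := hX x _ (hg.continuousAt hU)
  have hφe : Topology.IsClosedEmbedding φ := hφ.isClosedEmbedding hφinj
  obtain ⟨S, hS, hSc, hSφ⟩ := exists_mem_nhds_isClosed_subset (interior_mem_nhds.2 hφx)
  refine ⟨S, hS, fun A O f hA hO hAO hf hfg => ?_⟩
  -- A closed neighbourhood `A₁` of `A` inside `O` is kept as a buffer: agreement on `A₁`, not only
  -- on `A`, makes the glued lift continuous on an open set containing `A ∪ S`.
  obtain ⟨A₁, hA₁, hAA₁, hA₁O⟩ : ∃ A₁, IsClosed A₁ ∧ A ⊆ interior A₁ ∧ A₁ ⊆ O := by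
    obtain ⟨V, hV, hAV, hVO⟩ := normal_exists_closure_subset hA hO hAO
    exact ⟨closure V, isClosed_closure, hAV.trans (interior_maximal subset_closure hV), hVO⟩
  have hfU : Set.MapsTo (fun p => f (φ p)) (φ ⁻¹' O) (π ⁻¹' U) := by
    intro p hp
    rw [Set.mem_preimage, hfg _ hp]
    exact hφU ⟨p, rfl⟩
  obtain ⟨h, hh⟩ := SimplyConnectedSpace.exists_extension_square (hO.preimage hφ)
    (hA₁.preimage hφ) (Set.preimage_mono hA₁O) (fun p => a (f (φ p)))
    (ha.comp (hf.comp hφ.continuousOn fun p hp => hp) hfU)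
  obtain ⟨ψ, hψ⟩ : ∃ ψ : X → I × I, ∀ p, ψ (φ p) = p :=
    ⟨Function.invFun φ, Function.leftInverse_invFun hφinj⟩
  have hψc : ContinuousOn ψ (Set.range φ) := by
    rw [hφe.isEmbedding.isInducing.continuousOn_iff]
    refine continuousOn_id.congr ?_
    rintro _ ⟨p, rfl⟩
    simp [hψ]
  let f₂ : X → P := fun y => Ψ (g y) (h (ψ y))
  have hf₂ : ContinuousOn f₂ (Set.range φ) := by
    have h1 : ContinuousOn (fun y => (g y, h (ψ y))) (Set.range φ) :=
      hg.continuousOn.prodMk (h.continuous.comp_continuousOn hψc)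
    exact hΨ.comp h1 fun y hy => ⟨hφU hy, trivial⟩
  -- This is where the retraction identity `Ψ (π q) (a q) = q` enters: encoding `f` and decoding it
  -- returns `f`.
  have hff₂ : ∀ y ∈ A₁ ∩ Set.range φ, f₂ y = f y := by
    rintro _ ⟨hy, p, rfl⟩
    have := hh hy
    simp only [f₂, hψ, this]
    rw [← hfg _ (hA₁O hy)]
    exact hΨa _ (hfU (hA₁O hy))
  have hf'c : ContinuousOn (A₁.piecewise f f₂) (A₁ ∪ Set.range φ) := by
    refine ContinuousOn.union_of_isClosed ?_ ?_ hA₁ hφe.isClosed_range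
    · exact (hf.mono hA₁O).congr fun y hy => Set.piecewise_eq_of_mem _ _ _ hy
    · refine hf₂.congr fun y hy => ?_
      by_cases hy' : y ∈ A₁
      · rw [Set.piecewise_eq_of_mem _ _ _ hy', hff₂ y ⟨hy', hy⟩]
      · rw [Set.piecewise_eq_of_notMem _ _ _ hy']
  refine ⟨A ∪ S, interior A₁ ∪ interior (Set.range φ), A₁.piecewise f f₂, hA.union hSc,
    isOpen_interior.union isOpen_interior, Set.union_subset_union hAA₁ hSφ,
    hf'c.mono (Set.union_subset_union interior_subset interior_subset), ?_, subset_rfl, ?_⟩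
  · rintro y hy
    by_cases hy' : y ∈ A₁
    · rw [Set.piecewise_eq_of_mem _ _ _ hy', hfg y (hA₁O hy')]
    · rw [Set.piecewise_eq_of_notMem _ _ _ hy']
      exact hΨπ _ (hφU (interior_subset (hy.resolve_left fun h => hy' (interior_subset h)))) _
  · intro y hy
    exact Set.piecewise_eq_of_mem _ _ _ (interior_subset (hAA₁ hy))

/-- Let `π` be locally a retract of a product with simply connected fibre, and let `g` be a map from
a compact surface, possibly with boundary and corners, to its base. A lift of `g` defined near a
closed set `A` agrees on `A` with a global one. -/
theorem HasSimplyConnectedLocalModels.exists_lift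
    (hπ : HasSimplyConnectedLocalModels π) (hX : HasSquareNhds X) {g : X → M}
    (hg : Continuous g) {A O : Set X} (hA : IsClosed A) (hO : IsOpen O) (hAO : A ⊆ O) {f : X → P}
    (hf : ContinuousOn f O) (hfg : ∀ x ∈ O, π (f x) = g x) :
    ∃ f' : X → P, Continuous f' ∧ (∀ x, π (f' x) = g x) ∧ Set.EqOn f' f A := by
  have main := isCompact_univ (X := X).induction_on
    (p := fun S => ∀ (A O : Set X) (f : X → P), IsClosed A → IsOpen O → A ⊆ O → ContinuousOn f O →
      (∀ x ∈ O, π (f x) = g x) →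
      ∃ (A' O' : Set X) (f' : X → P), IsClosed A' ∧ IsOpen O' ∧ A' ⊆ O' ∧ ContinuousOn f' O' ∧
        (∀ x ∈ O', π (f' x) = g x) ∧ A ∪ S ⊆ A' ∧ Set.EqOn f' f A)
    (fun A O f hA hO hAO hf hfg => ⟨A, O, f, hA, hO, hAO, hf, hfg, by simp, fun _ _ => rfl⟩)
    (fun S T hST h A O f hA hO hAO hf hfg => by
      obtain ⟨A', O', f', h1, h2, h3, h4, h5, h6, h7⟩ := h A O f hA hO hAO hf hfg
      exact ⟨A', O', f', h1, h2, h3, h4, h5, (Set.union_subset_union_right _ hST).trans h6, h7⟩)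
    (fun S T hS hT A O f hA hO hAO hf hfg => by
      obtain ⟨A', O', f', h1, h2, h3, h4, h5, h6, h7⟩ := hS A O f hA hO hAO hf hfg
      obtain ⟨A'', O'', f'', k1, k2, k3, k4, k5, k6, k7⟩ := hT A' O' f' h1 h2 h3 h4 h5
      refine ⟨A'', O'', f'', k1, k2, k3, k4, k5, ?_, ?_⟩
      · rw [← Set.union_assoc]
        exact (Set.union_subset_union_left _ h6).trans k6
      · exact fun x hx => (k7 (h6 (Or.inl hx))).trans (h7 hx))
    (fun x _ => by
      obtain ⟨S, hS, h⟩ := hπ.exists_local_extension hX hg x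
      exact ⟨S, mem_nhdsWithin_of_mem_nhds hS, h⟩)
  obtain ⟨A', O', f', h1, h2, h3, h4, h5, h6, h7⟩ := main A O f hA hO hAO hf hfg
  have hO' : O' = Set.univ :=
    Set.univ_subset_iff.1 ((Set.subset_union_right.trans h6).trans h3)
  subst hO'
  exact ⟨f', continuousOn_univ.1 h4, fun x => h5 x trivial, h7⟩

end Sections

/-! ### Continuity of vector fields along maps, and of solutions of linear systems -/

section BundleContinuity

open Bundle

variable {B X F : Type*} {V : X → Type*} [TopologicalSpace B] [TopologicalSpace X]
  [NormedAddCommGroup F] [NormedSpace ℝ F] [∀ x, AddCommGroup (V x)] [∀ x, Module ℝ (V x)]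
  [∀ x, TopologicalSpace (V x)] [TopologicalSpace (TotalSpace F V)] [FiberBundle F V]
  [VectorBundle ℝ F V] {r : B → X} {b₀ : B}

/-- Near `b₀` a single trivialization turns the field into a map to the fixed space `F`, where
linear operations are known to be continuous. -/
theorem continuousAt_bundle_iff (hr : ContinuousAt r b₀) {v : ∀ b, V (r b)} :
    ContinuousAt (fun b => TotalSpace.mk' F (r b) (v b)) b₀ ↔
      ContinuousAt (fun b =>
        (trivializationAt F V (r b₀)).continuousLinearMapAt ℝ (r b) (v b)) b₀ := by
  rw [FiberBundle.continuousAt_totalSpace]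
  have hmem : ∀ᶠ b in 𝓝 b₀, r b ∈ (trivializationAt F V (r b₀)).baseSet :=
    hr.eventually ((trivializationAt F V (r b₀)).open_baseSet.mem_nhds
      (FiberBundle.mem_baseSet_trivializationAt F V (r b₀)))
  refine (and_iff_right hr).trans (continuousAt_congr ?_)
  filter_upwards [hmem] with b hb
  rw [Trivialization.continuousLinearMapAt_apply, Trivialization.coe_linearMapAt_of_mem _ hb]

theorem ContinuousAt.bundle_base {v : ∀ b, V (r b)}
    (hv : ContinuousAt (fun b => TotalSpace.mk' F (r b) (v b)) b₀) : ContinuousAt r b₀ :=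
  ((FiberBundle.continuousAt_totalSpace F _).1 hv).1

theorem ContinuousAt.bundle_add {v w : ∀ b, V (r b)}
    (hv : ContinuousAt (fun b => TotalSpace.mk' F (r b) (v b)) b₀)
    (hw : ContinuousAt (fun b => TotalSpace.mk' F (r b) (w b)) b₀) :
    ContinuousAt (fun b => TotalSpace.mk' F (r b) (v b + w b)) b₀ := by
  have hr := hv.bundle_base
  rw [continuousAt_bundle_iff hr] at hv hw ⊢
  simp only [map_add]
  exact hv.add hw

theorem ContinuousAt.bundle_smul {v : ∀ b, V (r b)} {c : B → ℝ} (hc : ContinuousAt c b₀)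
    (hv : ContinuousAt (fun b => TotalSpace.mk' F (r b) (v b)) b₀) :
    ContinuousAt (fun b => TotalSpace.mk' F (r b) (c b • v b)) b₀ := by
  have hr := hv.bundle_base
  rw [continuousAt_bundle_iff hr] at hv ⊢
  simp only [map_smul]
  exact hc.smul hv

theorem ContinuousAt.bundle_sum {ι : Type*} (s : Finset ι) {v : ι → ∀ b, V (r b)}
    (hr : ContinuousAt r b₀)
    (hv : ∀ i, ContinuousAt (fun b => TotalSpace.mk' F (r b) (v i b)) b₀) :
    ContinuousAt (fun b => TotalSpace.mk' F (r b) (∑ i ∈ s, v i b)) b₀ := by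
  simp only [continuousAt_bundle_iff hr] at hv ⊢
  simp only [map_sum]
  exact tendsto_finsetSum _ fun i _ => hv i

/-- Let `A b : V (p b) × W → V' (r b)` be bijective linear maps which take fields `(v, a)`
continuous at `b₀` to fields continuous at `b₀`. Then so do their inverses. -/
theorem continuousAt_of_continuousAt_image {Y G : Type*} {V' : Y → Type*} [TopologicalSpace Y]
    [NormedAddCommGroup G] [NormedSpace ℝ G] [∀ y, AddCommGroup (V' y)] [∀ y, Module ℝ (V' y)]
    [∀ y, TopologicalSpace (V' y)] [TopologicalSpace (TotalSpace G V')] [FiberBundle G V']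
    [VectorBundle ℝ G V'] [FiniteDimensional ℝ F] [FiniteDimensional ℝ G]
    {W : Type*} [NormedAddCommGroup W] [NormedSpace ℝ W] [FiniteDimensional ℝ W]
    {p : B → X} {r : B → Y} (hp : ContinuousAt p b₀) (hr : ContinuousAt r b₀)
    (A : ∀ b, (V (p b) × W) →ₗ[ℝ] V' (r b)) (hinj : Function.Bijective (A b₀))
    (hA : ∀ (v : ∀ b, V (p b)) (a : W), ContinuousAt (fun b => TotalSpace.mk' F (p b) (v b)) b₀ →
      ContinuousAt (fun b => TotalSpace.mk' G (r b) (A b (v b, a))) b₀)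
    {v : ∀ b, V (p b)} {a : B → W}
    (h : ContinuousAt (fun b => TotalSpace.mk' G (r b) (A b (v b, a b))) b₀) :
    ContinuousAt (fun b => TotalSpace.mk' F (p b) (v b)) b₀ ∧ ContinuousAt a b₀ := by
  let e := trivializationAt F V (p b₀)
  let e' := trivializationAt G V' (r b₀)
  have hmem : ∀ᶠ b in 𝓝 b₀, p b ∈ e.baseSet :=
    hp.eventually (e.open_baseSet.mem_nhds (FiberBundle.mem_baseSet_trivializationAt F V (p b₀)))
  have hmem' : ∀ᶠ b in 𝓝 b₀, r b ∈ e'.baseSet :=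
    hr.eventually (e'.open_baseSet.mem_nhds
      (FiberBundle.mem_baseSet_trivializationAt G V' (r b₀)))
  -- the maps `A b` in local trivializations
  let L : B → (F × W) →L[ℝ] G := fun b => LinearMap.toContinuousLinearMap
    ((e'.continuousLinearMapAt ℝ (r b)).toLinearMap ∘ₗ A b ∘ₗ
      ((e.symmL ℝ (p b)).toLinearMap.prodMap LinearMap.id))
  -- In finite dimensions continuity of a family of operators can be tested on fixed vectors, and a
  -- vector with constant coordinates is a field to which `hA` applies.
  have hL : ContinuousAt L b₀ := by
    refine continuousAt_clm_apply.2 fun z => ?_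
    have h1 : ContinuousAt (fun b => TotalSpace.mk' F (p b) (e.symmL ℝ (p b) z.1)) b₀ := by
      rw [continuousAt_bundle_iff hp]
      refine (continuousAt_const (y := z.1)).congr ?_
      filter_upwards [hmem] with b hb
      exact (e.continuousLinearMapAt_symmL hb z.1).symm
    exact (continuousAt_bundle_iff hr).1 (hA _ z.2 h1)
  have hbij : Function.Bijective (L b₀) := by
    have h1 : Function.Bijective (e'.continuousLinearMapAt ℝ (r b₀)) := by
      rw [← e'.coe_continuousLinearEquivAt_eq hmem'.self_of_nhds]
      exact (e'.continuousLinearEquivAt ℝ _ hmem'.self_of_nhds).bijective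
    have h2 : Function.Bijective (e.symmL ℝ (p b₀)) := by
      rw [← e.symm_continuousLinearEquivAt_eq hmem.self_of_nhds]
      exact (e.continuousLinearEquivAt ℝ _ hmem.self_of_nhds).symm.bijective
    exact h1.comp (hinj.comp (h2.prodMap Function.bijective_id))
  let L₀ : (F × W) ≃L[ℝ] G := (LinearEquiv.ofBijective (L b₀).toLinearMap hbij).toContinuousLinearEquiv
  have hL₀ : (L₀ : (F × W) →L[ℝ] G) = L b₀ := by ext <;> rfl
  -- Operator inversion is continuous at an invertible operator, so bijectivity is needed at `b₀`
  -- only.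
  have hinv : ContinuousAt (fun b => ContinuousLinearMap.inverse (L b)) b₀ := by
    have h1 := (contDiffAt_map_inverse (n := 0) L₀).continuousAt
    rw [hL₀] at h1
    exact ContinuousAt.comp (f := L) h1 hL
  have hinvb : ∀ᶠ b in 𝓝 b₀, (L b).IsInvertible := by
    have : {T : (F × W) →L[ℝ] G | T.IsInvertible} ∈ 𝓝 (L b₀) := by
      rw [← hL₀]
      exact ContinuousLinearEquiv.nhds L₀
    exact hL.eventually this
  have hsol : ContinuousAt (fun b => (e.continuousLinearMapAt ℝ (p b) (v b), a b)) b₀ := by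
    refine (hinv.clm_apply ((continuousAt_bundle_iff hr).1 h)).congr ?_
    filter_upwards [hmem, hinvb] with b hb hLb
    have : L b (e.continuousLinearMapAt ℝ (p b) (v b), a b) =
        e'.continuousLinearMapAt ℝ (r b) (A b (v b, a b)) := by
      change e'.continuousLinearMapAt ℝ (r b)
        (A b (e.symmL ℝ (p b) (e.continuousLinearMapAt ℝ (p b) (v b)), a b)) = _
      rw [e.symmL_continuousLinearMapAt hb]
    rw [← this]
    obtain ⟨T, hT⟩ := hLb
    rw [← hT]
    simp
  exact ⟨(continuousAt_bundle_iff hp).2 hsol.fst, hsol.snd⟩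

end BundleContinuity

/-! ### Spin structures have simply connected local models -/

section FrameTransport

set_option linter.unusedSectionVars false

open Bundle

variable {n : ℕ} {M : Type u} [TopologicalSpace M]
  [ChartedSpace (EuclideanSpace ℝ (Fin (n + 1))) M] [IsManifold (𝓡 (n + 1)) ∞ M]

/-- The `i`-th vector of a frame. -/
noncomputable def FrameBundle.vec (f : FrameBundle (n := n) M) (i : Fin (n + 1)) : TangentBundle (𝓡 (n + 1)) M :=
  ⟨f.1, f.2 i⟩

theorem FrameBundle.ext_vec {f f' : FrameBundle (n := n) M} (h₁ : f.1 = f'.1)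
    (h : ∀ i, f.vec i = f'.vec i) : f = f' := by
  obtain ⟨x, b⟩ := f
  obtain ⟨x', b'⟩ := f'
  dsimp only at h₁
  subst h₁
  congr 1
  refine Module.Basis.eq_of_apply_eq fun i => ?_
  have := h i
  unfold FrameBundle.vec at this
  exact eq_of_heq (TotalSpace.mk.inj this).2

theorem FrameBundle.continuous_vec (i : Fin (n + 1)) :
    Continuous fun f : FrameBundle (n := n) M => f.vec i := by
  have h : Continuous (fun (f : FrameBundle (n := n) M) (i : Fin (n + 1)) =>
      (⟨f.1, f.2 i⟩ : TangentBundle (𝓡 (n + 1)) M)) := continuous_induced_dom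
  exact continuous_pi_iff.1 h i

theorem FrameBundle.continuous_of_vec {B : Type*} [TopologicalSpace B]
    {f : B → FrameBundle (n := n) M} (h : ∀ i, Continuous fun b => (f b).vec i) : Continuous f :=
  continuous_induced_rng.2 (continuous_pi h)

theorem FrameBundle.continuous_fst : Continuous fun f : FrameBundle (n := n) M => f.1 :=
  (FiberBundle.continuous_proj (EuclideanSpace ℝ (Fin (n + 1))) _).comp
    (FrameBundle.continuous_vec (0 : Fin (n + 1)))

/-- The frame with the first vector negated. -/
noncomputable def FrameBundle.reflect (f : FrameBundle (n := n) M) : FrameBundle (n := n) M :=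
  ⟨f.1, f.2.unitsSMul (Function.update 1 0 (-1))⟩

theorem FrameBundle.continuous_reflect :
    Continuous (FrameBundle.reflect : FrameBundle (n := n) M → FrameBundle (n := n) M) := by
  refine FrameBundle.continuous_of_vec fun i => ?_
  have : ∀ f : FrameBundle (n := n) M, f.reflect.vec i =
      ⟨f.1, (((Function.update 1 0 (-1) : Fin (n + 1) → ℝˣ) i : ℝˣ) : ℝ) • f.2 i⟩ := fun f => by
    refine congrArg (TotalSpace.mk f.1) ?_
    exact Module.Basis.unitsSMul_apply i
  simp only [this]
  exact continuous_iff_continuousAt.2 fun f =>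
    ContinuousAt.bundle_smul continuousAt_const (FrameBundle.continuous_vec i).continuousAt

theorem FrameBundle.orientation_reflect (f : FrameBundle (n := n) M) :
    f.reflect.2.orientation = -f.2.orientation :=
  f.2.orientation_neg_single 0

/-- A frame fails to be positive exactly when its reflection is positive, so the complement is the
preimage of an open set under a continuous map. -/
theorem TangentOrientation.isClopen_positive (o : TangentOrientation n M) :
    IsClopen {f : FrameBundle (n := n) M | f.2.orientation = o.orientation f.1} := by
  refine ⟨⟨?_⟩, o.isOpen_positive⟩
  convert o.isOpen_positive.preimage FrameBundle.continuous_reflect using 1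
  ext f
  have h1 : f ∈ FrameBundle.reflect ⁻¹' {f : FrameBundle (n := n) M |
      f.2.orientation = o.orientation f.1} ↔ -f.2.orientation = o.orientation f.1 := by
    rw [← f.orientation_reflect]
    rfl
  exact (Set.mem_compl_iff _ _).trans <| (ne_comm (a := f.2.orientation)).trans <|
    (f.2.orientation_ne_iff_eq_neg (o.orientation f.1)).trans
    (eq_comm.trans h1.symm)

/-- The frame at `y` which has the same coordinates as the frame `f` in the trivialization of the
tangent bundle at `m`. -/
noncomputable def FrameBundle.transport (m : M) (f : FrameBundle (n := n) M) (y : M)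
    (hf : f.1 ∈ (trivializationAt (EuclideanSpace ℝ (Fin (n + 1)))
      (TangentSpace (𝓡 (n + 1)) : M → Type _) m).baseSet)
    (hy : y ∈ (trivializationAt (EuclideanSpace ℝ (Fin (n + 1)))
      (TangentSpace (𝓡 (n + 1)) : M → Type _) m).baseSet) : FrameBundle (n := n) M :=
  ⟨y, f.2.map (((trivializationAt (EuclideanSpace ℝ (Fin (n + 1)))
      (TangentSpace (𝓡 (n + 1)) : M → Type _) m).linearEquivAt ℝ f.1 hf).trans
    ((trivializationAt (EuclideanSpace ℝ (Fin (n + 1)))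
      (TangentSpace (𝓡 (n + 1)) : M → Type _) m).linearEquivAt ℝ y hy).symm)⟩

theorem FrameBundle.vec_transport (m : M) (f : FrameBundle (n := n) M) (y : M) (hf) (hy)
    (i : Fin (n + 1)) : (f.transport m y hf hy).vec i =
      (trivializationAt (EuclideanSpace ℝ (Fin (n + 1)))
        (TangentSpace (𝓡 (n + 1)) : M → Type _) m).toOpenPartialHomeomorph.symm
        (y, (trivializationAt (EuclideanSpace ℝ (Fin (n + 1)))
        (TangentSpace (𝓡 (n + 1)) : M → Type _) m (f.vec i)).2) := by
  set e := trivializationAt (EuclideanSpace ℝ (Fin (n + 1)))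
    (TangentSpace (𝓡 (n + 1)) : M → Type _) m
  rw [← e.mk_symm hy]
  rfl

theorem FrameBundle.transport_self (m : M) (f : FrameBundle (n := n) M) (hf) (hy) :
    f.transport m f.1 hf hy = f := by
  refine FrameBundle.ext_vec rfl fun i => ?_
  rw [FrameBundle.vec_transport]
  set e := trivializationAt (EuclideanSpace ℝ (Fin (n + 1)))
    (TangentSpace (𝓡 (n + 1)) : M → Type _) m
  have h : f.vec i ∈ e.source := e.mem_source.2 hf
  have h2 : e (f.vec i) = (f.1, (e (f.vec i)).2) := Prod.ext (e.coe_fst h) rfl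
  rw [← h2]
  exact e.toOpenPartialHomeomorph.left_inv h

/-- Both sides have the coordinates of `f` in the trivialization at `m`, so the intermediate point
drops out. This makes transport reversible. -/
theorem FrameBundle.transport_transport (m : M) (f : FrameBundle (n := n) M) (y z : M) (hf) (hy)
    (hz) (hy') : (f.transport m y hf hy).transport m z hy' hz = f.transport m z hf hz := by
  refine FrameBundle.ext_vec rfl fun i => ?_
  rw [FrameBundle.vec_transport, FrameBundle.vec_transport, FrameBundle.vec_transport]
  set e := trivializationAt (EuclideanSpace ℝ (Fin (n + 1)))
    (TangentSpace (𝓡 (n + 1)) : M → Type _) m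
  have h : (y, (e (f.vec i)).2) ∈ e.target := e.mem_target.2 hy
  have h2 : e (e.toOpenPartialHomeomorph.symm (y, (e (f.vec i)).2)) = _ :=
    e.toOpenPartialHomeomorph.right_inv h
  rw [h2]

theorem FrameBundle.continuous_transport {B : Type*} [TopologicalSpace B] (m : M)
    {f : B → FrameBundle (n := n) M} {y : B → M} (hf : Continuous f) (hy : Continuous y)
    (h : ∀ b, (f b).1 ∈ (trivializationAt (EuclideanSpace ℝ (Fin (n + 1)))
      (TangentSpace (𝓡 (n + 1)) : M → Type _) m).baseSet)
    (h' : ∀ b, y b ∈ (trivializationAt (EuclideanSpace ℝ (Fin (n + 1)))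
      (TangentSpace (𝓡 (n + 1)) : M → Type _) m).baseSet) :
    Continuous fun b => (f b).transport m (y b) (h b) (h' b) := by
  refine FrameBundle.continuous_of_vec fun i => ?_
  simp only [FrameBundle.vec_transport]
  set e := trivializationAt (EuclideanSpace ℝ (Fin (n + 1)))
    (TangentSpace (𝓡 (n + 1)) : M → Type _) m
  have h1 : Continuous fun b => e ((f b).vec i) :=
    e.continuousOn.comp_continuous ((FrameBundle.continuous_vec i).comp hf) fun b =>
      e.mem_source.2 (h b)
  exact e.toOpenPartialHomeomorph.continuousOn_symm.comp_continuous
    (hy.prodMk h1.snd) fun b => e.mem_target.2 (h' b)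

/-- The base point of an element of a spin structure. -/
def SpinStructure.base {o : TangentOrientation n M} (σ : SpinStructure o) (p : σ.P) : M :=
  (σ.proj p).1.1

theorem SpinStructure.continuous_base {o : TangentOrientation n M} (σ : SpinStructure o) :
    Continuous σ.base :=
  FrameBundle.continuous_fst.comp (continuous_subtype_val.comp σ.isCoveringMap.continuous)

/-- A spin structure is, over the base, locally a retract of a product with simply connected
fibre. The retraction moves a point to the fibre over the centre of a coordinate ball, by lifting
the transport of frames along straight segments. -/
theorem SpinStructure.hasSimplyConnectedLocalModels {o : TangentOrientation n M}
    (σ : SpinStructure o) : HasSimplyConnectedLocalModels σ.base := by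
  intro m
  set e := trivializationAt (EuclideanSpace ℝ (Fin (n + 1)))
    (TangentSpace (𝓡 (n + 1)) : M → Type _) m with he
  set φ := chartAt (EuclideanSpace ℝ (Fin (n + 1))) m
  obtain ⟨ε, hε, hball⟩ := Metric.isOpen_iff.1 φ.open_target _ (mem_chart_target _ m)
  set U : Set M := φ.source ∩ φ ⁻¹' Metric.ball (φ m) ε with hUdef
  have hUo : IsOpen U := φ.isOpen_inter_preimage Metric.isOpen_ball
  have hmU : m ∈ U := ⟨mem_chart_source _ m, Metric.mem_ball_self hε⟩
  have hUe : ∀ u ∈ U, u ∈ e.baseSet := fun u hu => hu.1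
  -- straight segments in the coordinate ball
  let seg : unitInterval → M → M → M := fun t u v => φ.symm (AffineMap.lineMap (φ u) (φ v) (t : ℝ))
  have hlin : ∀ t u v, u ∈ U → v ∈ U →
      AffineMap.lineMap (φ u) (φ v) ((t : unitInterval) : ℝ) ∈ Metric.ball (φ m) ε := fun t u v hu hv =>
    (convex_ball _ _).lineMap_mem hu.2 hv.2 t.2
  have hsegU : ∀ t u v, u ∈ U → v ∈ U → seg t u v ∈ U := fun t u v hu hv => by
    have h := hlin t u v hu hv
    exact ⟨φ.map_target (hball h), by rwa [Set.mem_preimage, φ.right_inv (hball h)]⟩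
  have hseg0 : ∀ u v, u ∈ U → seg 0 u v = u := fun u v hu => by
    simp [seg, φ.left_inv hu.1]
  have hseg1 : ∀ u v, v ∈ U → seg 1 u v = v := fun u v hu => by
    simp [seg, φ.left_inv hu.1]
  have hsegσ : ∀ t u v, seg (unitInterval.symm t) u v = seg t v u := fun t u v => by
    simp only [seg, unitInterval.coe_symm_eq]
    rw [AffineMap.lineMap_apply_one_sub]
  -- All pairs of a starting element and a target point form one parameter space, so a single lifted
  -- homotopy yields every transport, jointly continuously.
  let A := {a : σ.P × M // σ.base a.1 ∈ U ∧ a.2 ∈ U}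
  have hφc : ∀ {B : Type (max 0 u)} [TopologicalSpace B] {y : B → M}, Continuous y → (∀ b, y b ∈ U) →
      Continuous fun b => φ (y b) := fun hy hyU =>
    φ.continuousOn.comp_continuous hy fun b => (hyU b).1
  let pt : unitInterval × A → M := fun z => seg z.1 (σ.base z.2.1.1) z.2.1.2
  have hptU : ∀ z, pt z ∈ U := fun z => hsegU _ _ _ z.2.2.1 z.2.2.2
  have hA1 : Continuous fun z : unitInterval × A => z.2.1.1 :=
    continuous_fst.comp (continuous_subtype_val.comp continuous_snd)
  have hA2 : Continuous fun z : unitInterval × A => z.2.1.2 :=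
    continuous_snd.comp (continuous_subtype_val.comp continuous_snd)
  have hpt : Continuous pt := by
    have h1 : Continuous fun z : unitInterval × A => φ (σ.base z.2.1.1) :=
      hφc (σ.continuous_base.comp hA1) fun z => z.2.2.1
    have h2 : Continuous fun z : unitInterval × A => φ z.2.1.2 := hφc hA2 fun z => z.2.2.2
    refine φ.continuousOn_symm.comp_continuous ?_ fun z => hball (hlin _ _ _ z.2.2.1 z.2.2.2)
    simp only [AffineMap.lineMap_apply_module]
    have h3 : Continuous fun z : unitInterval × A => (z.1 : ℝ) :=
      continuous_subtype_val.comp _root_.continuous_fst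
    exact ((continuous_const.sub h3).smul h1).add (h3.smul h2)
  let H₀ : unitInterval × A → FrameBundle (n := n) M := fun z =>
    (σ.proj z.2.1.1).1.transport m (pt z) (hUe _ z.2.2.1) (hUe _ (hptU z))
  have hH₀ : Continuous H₀ := by
    refine FrameBundle.continuous_transport m ?_ hpt _ _
    exact continuous_subtype_val.comp (σ.isCoveringMap.continuous.comp hA1)
  have hH₀0 : ∀ a : A, H₀ (0, a) = (σ.proj a.1.1).1 := by
    intro a
    have h : pt (0, a) = (σ.proj a.1.1).1.1 := hseg0 _ _ a.2.1
    have : ∀ y (hy) (hy'), y = (σ.proj a.1.1).1.1 →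
        (σ.proj a.1.1).1.transport m y hy hy' = (σ.proj a.1.1).1 := by
      rintro y hy hy' rfl
      exact FrameBundle.transport_self m _ _ _
    exact this _ _ _ h
  have hH₀pos : ∀ z, (H₀ z).2.orientation = o.orientation (H₀ z).1 := by
    rintro ⟨t, a⟩
    -- Positivity of the moving frame is clopen in time and holds at time zero, and the interval is
    -- connected.
    have hcl : IsClopen {t : unitInterval | (H₀ (t, a)).2.orientation = o.orientation (H₀ (t, a)).1} :=
      o.isClopen_positive.preimage (hH₀.comp (by fun_prop : Continuous fun t : unitInterval => (t, a)))
    have h0 : (0 : unitInterval) ∈ {t : unitInterval | (H₀ (t, a)).2.orientation = o.orientation (H₀ (t, a)).1} := by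
      rw [Set.mem_ofPred_eq, hH₀0]
      exact (σ.proj a.1.1).2
    have := hcl.eq_univ ⟨0, h0⟩
    exact (this.symm ▸ Set.mem_univ t :
      t ∈ {t : unitInterval | (H₀ (t, a)).2.orientation = o.orientation (H₀ (t, a)).1})
  let H : C(unitInterval × A, o.Frames) := ⟨fun z => ⟨H₀ z, hH₀pos z⟩, hH₀.subtype_mk _⟩
  let f₀ : C(A, σ.P) := ⟨fun a => a.1.1, by fun_prop⟩
  have hHf : ∀ a, H (0, a) = σ.proj (f₀ a) := fun a => Subtype.ext (hH₀0 a)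
  let L := σ.isCoveringMap.liftHomotopy H f₀ hHf
  have hL : ∀ z, σ.proj (L z) = H z := fun z =>
    congrFun (σ.isCoveringMap.liftHomotopy_lifts H f₀ hHf) z
  have hL0 : ∀ a, L (0, a) = a.1.1 := σ.isCoveringMap.liftHomotopy_zero H f₀ hHf
  have hbase : ∀ z, σ.base (L z) = pt z := fun z =>
    congrArg (fun f : o.Frames => f.1.1) (hL z)
  have hbase1 : ∀ a, σ.base (L (1, a)) = a.1.2 := fun a => by
    rw [hbase]
    exact hseg1 _ _ a.2.2
  -- the transport is undone by the transport in the opposite direction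
  have hback : ∀ (a : A) (h : σ.base (L (1, a)) ∈ U ∧ σ.base a.1.1 ∈ U),
      L (1, ⟨(L (1, a), σ.base a.1.1), h⟩) = a.1.1 := by
    intro a h
    set a' : A := ⟨(L (1, a), σ.base a.1.1), h⟩ with ha'
    -- The return path and the reversed outgoing path lift the same path of frames and both start at
    -- `L (1, a)`; uniqueness of lifts identifies them.
    have := σ.isCoveringMap.eq_of_comp_eq (A := unitInterval) (g₁ := fun t => L (t, a'))
      (g₂ := fun t => L (unitInterval.symm t, a)) (by fun_prop) (by fun_prop) ?_ 0 ?_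
    · have h1 := congrFun this 1
      simp only [unitInterval.symm_one, hL0] at h1
      exact h1
    · funext t
      simp only [Function.comp_apply, hL]
      refine Subtype.ext ?_
      have hpteq : pt (t, a') = pt (unitInterval.symm t, a) := by
        simp only [pt, hsegσ, ha', hbase1]
      have h1 : ∀ f : FrameBundle (n := n) M, f = H₀ (1, a) → ∀ y hf hy,
          f.transport m y hf hy = (σ.proj a.1.1).1.transport m y (hUe _ a.2.1) hy := by
        rintro f rfl y hf hy
        exact FrameBundle.transport_transport m _ _ _ _ _ _ _
      have h2 : ∀ y y' hy hy', y = y' → (σ.proj a.1.1).1.transport m y (hUe _ a.2.1) hy =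
          (σ.proj a.1.1).1.transport m y' (hUe _ a.2.1) hy' := by
        rintro y _ hy hy' rfl
        rfl
      exact (h1 _ (congrArg Subtype.val (hL (1, a))) _ _ _).trans (h2 _ _ _ _ hpteq)
    · simp [hL0, ha']
  have hsc := σ.simplyConnected m
  classical
  let F := {p : σ.P // (σ.proj p).1.1 = m}
  -- `a` carries a point to the fibre over `m` and `Ψ` carries it back; the values off `U` are never
  -- used.
  let a : σ.P → F := fun q => if h : σ.base q ∈ U then ⟨L (1, ⟨(q, m), h, hmU⟩), hbase1 _⟩
    else Classical.arbitrary F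
  have hFU : ∀ p : F, σ.base p.1 ∈ U := fun p => by
    have : σ.base p.1 = m := p.2
    rw [this]
    exact hmU
  let Ψ : M → F → σ.P := fun u p => if h : u ∈ U then L (1, ⟨(p.1, u), hFU p, h⟩) else p.1
  refine ⟨U, hUo.mem_nhds hmU, F, inferInstance, hsc, a, Ψ, ?_, ?_, ?_, ?_⟩
  · rw [continuousOn_iff_continuous_domRestrict]
    have : (σ.base ⁻¹' U).domRestrict a = fun q : σ.base ⁻¹' U =>
        (⟨L (1, ⟨(q.1, m), q.2, hmU⟩), hbase1 _⟩ : F) := funext fun q => dif_pos q.2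
    rw [this]
    refine Continuous.subtype_mk (L.continuous.comp (continuous_const.prodMk ?_)) _
    exact Continuous.subtype_mk (continuous_subtype_val.prodMk continuous_const) _
  · rw [continuousOn_iff_continuous_domRestrict]
    have : (U ×ˢ Set.univ).domRestrict (Function.uncurry Ψ) = fun z : U ×ˢ (Set.univ : Set F) =>
        L (1, ⟨(z.1.2.1, z.1.1), hFU _, z.2.1⟩) := funext fun z => dif_pos z.2.1
    rw [this]
    refine L.continuous.comp (continuous_const.prodMk (Continuous.subtype_mk ?_ _))
    exact (continuous_subtype_val.comp (_root_.continuous_snd.comp continuous_subtype_val)).prodMk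
      (_root_.continuous_fst.comp continuous_subtype_val)
  · intro u hu p
    simp only [Ψ, dif_pos hu]
    exact hbase1 _
  · intro q hq
    simp only [Ψ, a, dif_pos hq]
    refine hback ⟨(q, m), hq, hmU⟩ ⟨?_, hq⟩
    rw [hbase1]
    exact hmU

end FrameTransport

/-! ### Stable trivializations obtained from a frame and a normal trivialization -/

section Splitting

open Bundle

variable {E H E' H' : Type*} [NormedAddCommGroup E] [NormedSpace ℝ E] [TopologicalSpace H]
  {I : ModelWithCorners ℝ E H}
  [NormedAddCommGroup E'] [NormedSpace ℝ E'] [TopologicalSpace H']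
  {J : ModelWithCorners ℝ E' H'}
  {S X : Type*} [TopologicalSpace S] [ChartedSpace H S] [IsManifold I 1 S]
  [TopologicalSpace X] [ChartedSpace H' X] [IsManifold J 1 X]
  {g : S → X} {r d : ℕ}

theorem StableTriv.ext_vec {l : ℕ} {s s' : StableTriv I S d l}
    (h : ∀ i x, s.vec i x = s'.vec i x) : s = s' := by
  cases s
  cases s'
  congr
  funext i x
  exact h i x

/-- The map `(v, a) ↦ dg(v) + ∑ a_j ν_j`. -/
noncomputable def NormalTriv.splitting (ν : NormalTriv I J g r) (x : S) :
    (TangentSpace I x × (Fin r → ℝ)) →ₗ[ℝ] TangentSpace J (g x) :=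
  (mfderiv I J g x).toLinearMap.coprod (Fintype.linearCombination ℝ fun j => ν.vec j x)

theorem NormalTriv.splitting_apply (ν : NormalTriv I J g r) (x : S) (v : TangentSpace I x)
    (a : Fin r → ℝ) : ν.splitting x (v, a) = mfderiv I J g x v + ∑ j, a j • ν.vec j x :=
  rfl

/-- Modulo the image of `dg` only the normal part survives, so independence there kills `a`;
injectivity of `dg` then kills `v`. -/
theorem NormalTriv.injective_splitting (ν : NormalTriv I J g r) {x : S}
    (hg : Function.Injective (mfderiv I J g x)) : Function.Injective (ν.splitting x) := by
  rw [← LinearMap.ker_eq_bot, LinearMap.ker_eq_bot']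
  rintro ⟨v, a⟩ h
  rw [ν.splitting_apply] at h
  have hli := Fintype.linearIndependent_iff.1 (ν.linearIndependent x) a (by
    simp only [← map_smul, ← map_sum]
    rw [Submodule.mkQ_apply, Submodule.Quotient.mk_eq_zero]
    exact ⟨-v, by
      rw [map_neg]
      exact neg_eq_of_add_eq_zero_right h⟩)
  have ha : a = 0 := funext hli
  subst ha
  have hv : mfderiv I J g x v = 0 := by simpa using h
  rw [hg (hv.trans (map_zero _).symm)]
  rfl

theorem NormalTriv.bijective_splitting [FiniteDimensional ℝ E] [FiniteDimensional ℝ E']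
    (ν : NormalTriv I J g r) {x : S}
    (hg : Function.Injective (mfderiv I J g x))
    (hrank : Module.finrank ℝ E' = Module.finrank ℝ E + r) :
    Function.Bijective (ν.splitting x) := by
  have : FiniteDimensional ℝ (TangentSpace I x) := inferInstanceAs (FiniteDimensional ℝ E)
  have : FiniteDimensional ℝ (TangentSpace J (g x)) := inferInstanceAs (FiniteDimensional ℝ E')
  have h := ν.injective_splitting hg
  refine ⟨h, (LinearMap.injective_iff_surjective_of_finrank_eq_finrank ?_).1 h⟩
  rw [Module.finrank_prod, Module.finrank_fin_fun]
  exact hrank.symm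

/-- If the maps `(v, a) ↦ dg(v) + ∑ a_j ν_j` of a continuous family are bijective, then their
inverses take continuous fields to continuous fields. -/
theorem NormalTriv.continuous_of_splitting [FiniteDimensional ℝ E] [FiniteDimensional ℝ E']
    {B : Type*} [TopologicalSpace B] {p : B → S} (hp : Continuous p) (hg : ContMDiff I J 1 g)
    (hinj : ∀ x, Function.Injective (mfderiv I J g x))
    (hrank : Module.finrank ℝ E' = Module.finrank ℝ E + r)
    {ν : B → NormalTriv I J g r}
    (hν : ∀ j, Continuous fun b => (⟨g (p b), (ν b).vec j (p b)⟩ : TangentBundle J X))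
    {w : ∀ b, TangentSpace I (p b) × (Fin r → ℝ)}
    (hw : Continuous fun b => (⟨g (p b), (ν b).splitting (p b) (w b)⟩ : TangentBundle J X)) :
    (Continuous fun b => (⟨p b, (w b).1⟩ : TangentBundle I S)) ∧ Continuous fun b => (w b).2 := by
  rw [continuous_iff_continuousAt, continuous_iff_continuousAt, ← forall_and]
  intro b₀
  refine continuousAt_of_continuousAt_image (p := p)
    (r := fun b => g (p b)) (V := (TangentSpace I : S → Type _))
    (V' := (TangentSpace J : X → Type _)) hp.continuousAt
    (hg.continuous.continuousAt.comp hp.continuousAt)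
    (fun b => (ν b).splitting (p b)) ((ν b₀).bijective_splitting (hinj _) hrank) ?_
    hw.continuousAt
  intro v a hv
  simp only [NormalTriv.splitting_apply]
  refine ContinuousAt.bundle_add ?_ (ContinuousAt.bundle_sum _ ?_ fun j => ?_)
  · exact (hg.continuous_tangentMap le_rfl).continuousAt.comp hv
  · exact hg.continuous.continuousAt.comp hp.continuousAt
  · exact ContinuousAt.bundle_smul continuousAt_const (hν j).continuousAt

/-- The trivialization `s` of `TS ⊕ ε^r` is mapped by `(v, a) ↦ dg(v) + ∑ a_j ν_j` to the frame
`e` along `g`. -/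
def NormalTriv.MapsTo (ν : NormalTriv I J g r) (s : StableTriv I S d r)
    (e : Fin (r + d) → ∀ x, TangentSpace J (g x)) : Prop :=
  ∀ i x, ν.splitting x (s.vec i x) = e i x

theorem NormalTriv.MapsTo.unique {ν : NormalTriv I J g r} {s s' : StableTriv I S d r}
    {e : Fin (r + d) → ∀ x, TangentSpace J (g x)} (h : ν.MapsTo s e) (h' : ν.MapsTo s' e)
    (hinj : ∀ x, Function.Injective (mfderiv I J g x)) : s = s' :=
  StableTriv.ext_vec fun i x =>
    ν.injective_splitting (hinj x) ((h i x).trans (h' i x).symm)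

/-- Pull the frame back pointwise along the splitting isomorphisms. The parameter space `T` is a
point when a trivialization is wanted and an interval when a homotopy is wanted. -/
theorem exists_stableTriv_family [FiniteDimensional ℝ E] [FiniteDimensional ℝ E']
    {T : Type*} [TopologicalSpace T] (hg : ContMDiff I J 1 g)
    (hinj : ∀ x, Function.Injective (mfderiv I J g x))
    (hrank : Module.finrank ℝ E' = Module.finrank ℝ E + r)
    {ν : T → NormalTriv I J g r}
    (hν : ∀ j, Continuous fun p : T × S => (⟨g p.2, (ν p.1).vec j p.2⟩ : TangentBundle J X))
    {e : T → Fin (r + d) → ∀ x, TangentSpace J (g x)}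
    (he : ∀ i, Continuous fun p : T × S => (⟨g p.2, e p.1 i p.2⟩ : TangentBundle J X))
    (hli : ∀ t x, LinearIndependent ℝ fun i => e t i x) :
    ∃ K : T → StableTriv I S d r,
      (∀ i, Continuous fun p : T × S => (⟨p.2, ((K p.1).vec i p.2).1⟩ : TangentBundle I S)) ∧
      (∀ i, Continuous fun p : T × S => ((K p.1).vec i p.2).2) ∧
      ∀ t, (ν t).MapsTo (K t) (e t) := by
  have hsurj : ∀ t x i, ∃ w, (ν t).splitting x w = e t i x := fun t x i =>
    ((ν t).bijective_splitting (hinj x) hrank).2 _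
  choose w hw using hsurj
  have hc : ∀ i, (Continuous fun p : T × S => (⟨p.2, (w p.1 p.2 i).1⟩ : TangentBundle I S)) ∧
      Continuous fun p : T × S => (w p.1 p.2 i).2 := fun i => by
    refine NormalTriv.continuous_of_splitting (ν := fun p : T × S => ν p.1)
      (w := fun p : T × S => w p.1 p.2 i) _root_.continuous_snd hg hinj hrank hν ?_
    simp only [hw]
    exact he i
  refine ⟨fun t => ⟨fun i x => w t x i, fun i => ?_, fun i => ?_, fun x => ?_⟩,
    fun i => (hc i).1, fun i => (hc i).2, fun t i x => hw t x i⟩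
  · exact (hc i).1.comp (Continuous.prodMk_right t)
  · exact (hc i).2.comp (Continuous.prodMk_right t)
  · refine LinearIndependent.of_comp ((ν t).splitting x) ?_
    have : (fun i => e t i x) = (ν t).splitting x ∘ fun i => w t x i :=
      funext fun i => (hw t x i).symm
    rw [← this]
    exact hli t x

theorem NormalTriv.exists_mapsTo [FiniteDimensional ℝ E] [FiniteDimensional ℝ E']
    (ν : NormalTriv I J g r) (hg : ContMDiff I J 1 g)
    (hinj : ∀ x, Function.Injective (mfderiv I J g x))
    (hrank : Module.finrank ℝ E' = Module.finrank ℝ E + r)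
    {e : Fin (r + d) → ∀ x, TangentSpace J (g x)}
    (he : ∀ i, Continuous fun x => (⟨g x, e i x⟩ : TangentBundle J X))
    (hli : ∀ x, LinearIndependent ℝ fun i => e i x) :
    ∃ s : StableTriv I S d r, ν.MapsTo s e := by
  obtain ⟨K, -, -, hK⟩ := exists_stableTriv_family (T := Unit) (ν := fun _ => ν)
    (e := fun _ => e) hg hinj hrank (fun j => (ν.continuous_vec j).comp _root_.continuous_snd)
    (fun i => (he i).comp continuous_snd) fun _ => hli
  exact ⟨K (), hK ()⟩

/-- Pulling back the moving frame along the moving splitting gives a homotopy, whose ends are the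
given trivializations because preimages under a splitting are unique. -/
theorem NormalTriv.MapsTo.homotopic [FiniteDimensional ℝ E] [FiniteDimensional ℝ E']
    (hg : ContMDiff I J 1 g) (hinj : ∀ x, Function.Injective (mfderiv I J g x))
    (hrank : Module.finrank ℝ E' = Module.finrank ℝ E + r)
    {ν : unitInterval → NormalTriv I J g r}
    (hν : ∀ j, Continuous fun p : unitInterval × S =>
      (⟨g p.2, (ν p.1).vec j p.2⟩ : TangentBundle J X))
    {e : unitInterval → Fin (r + d) → ∀ x, TangentSpace J (g x)}
    (he : ∀ i, Continuous fun p : unitInterval × S =>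
      (⟨g p.2, e p.1 i p.2⟩ : TangentBundle J X))
    (hli : ∀ t x, LinearIndependent ℝ fun i => e t i x) {s s' : StableTriv I S d r}
    (hs : (ν 0).MapsTo s (e 0)) (hs' : (ν 1).MapsTo s' (e 1)) : s.Homotopic s' := by
  obtain ⟨K, h1, h2, h3⟩ := exists_stableTriv_family hg hinj hrank hν he hli
  exact ⟨K, h1, h2, (h3 0).unique hs hinj, (h3 1).unique hs' hinj⟩

theorem StableTriv.stabilize_refl {l : ℕ} (s : StableTriv I S d l) : s.stabilize le_rfl = s := by
  refine StableTriv.ext_vec fun i x => ?_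
  simp [StableTriv.stabilize]

theorem StableTriv.framing_eq_of_homotopic {l : ℕ} {s s' : StableTriv I S d l}
    (h : s.Homotopic s') : s.framing = s'.framing :=
  Quot.sound ⟨l, le_rfl, le_rfl, by rwa [s.stabilize_refl, s'.stabilize_refl]⟩

theorem StableTriv.Homotopic.refl {l : ℕ} (s : StableTriv I S d l) : s.Homotopic s :=
  ⟨fun _ => s, fun i => (s.continuous_fst i).comp _root_.continuous_snd,
    fun i => (s.continuous_snd i).comp _root_.continuous_snd, rfl, rfl⟩

theorem StableTriv.framing_stabilize {l L : ℕ} (s : StableTriv I S d l) (hL : l ≤ L) :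
    (s.stabilize hL).framing = s.framing :=
  Quot.sound ⟨L, le_rfl, hL, by rw [StableTriv.stabilize_refl]; exact .refl _⟩

/-- The stable framing obtained from a frame along `g` and a normal trivialization depends only on
the normal framing. -/
theorem NormalTriv.MapsTo.framing_eq [FiniteDimensional ℝ E] [FiniteDimensional ℝ E']
    (hg : ContMDiff I J 1 g) (hinj : ∀ x, Function.Injective (mfderiv I J g x))
    (hrank : Module.finrank ℝ E' = Module.finrank ℝ E + r)
    {e : Fin (r + d) → ∀ x, TangentSpace J (g x)}
    (he : ∀ i, Continuous fun x => (⟨g x, e i x⟩ : TangentBundle J X))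
    (hli : ∀ x, LinearIndependent ℝ fun i => e i x)
    {ν ν' : NormalTriv I J g r} (hν : ν.framing = ν'.framing) {s s' : StableTriv I S d r}
    (hs : ν.MapsTo s e) (hs' : ν'.MapsTo s' e) : s.framing = s'.framing := by
  choose sol hsol using fun ν : NormalTriv I J g r => ν.exists_mapsTo hg hinj hrank he hli
  have key : ∀ ν ν' : NormalTriv I J g r, ν.Homotopic ν' →
      (sol ν).framing = (sol ν').framing := by
    rintro ν ν' ⟨K, hK, rfl, rfl⟩
    exact StableTriv.framing_eq_of_homotopic
      (NormalTriv.MapsTo.homotopic (e := fun _ => e) hg hinj hrank hK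
        (fun i => (he i).comp _root_.continuous_snd) (fun _ => hli) (hsol _) (hsol _))
  rw [hs.unique (hsol ν) hinj, hs'.unique (hsol ν') hinj]
  -- Equality of framings is equality in a quotient and need not hand back one homotopy; it is used
  -- by descending `sol` to the quotient.
  exact congrArg (Quot.lift (fun ν => (sol ν).framing) key) hν

end Splitting

/-! ### Immersions have injective derivative -/

section Immersions

open Bundle

variable {E H E' H' : Type*} [NormedAddCommGroup E] [NormedSpace ℝ E] [TopologicalSpace H]
  {I : ModelWithCorners ℝ E H}
  [NormedAddCommGroup E'] [NormedSpace ℝ E'] [TopologicalSpace H']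
  {J : ModelWithCorners ℝ E' H'}
  {S X : Type*} [TopologicalSpace S] [ChartedSpace H S]
  [TopologicalSpace X] [ChartedSpace H' X] {g : S → X} {k : ℕ∞ω}

theorem injective_mfderiv_extend [IsManifold I k S] (hk : k ≠ 0) {e : OpenPartialHomeomorph S H}
    (he : e ∈ IsManifold.maximalAtlas I k S) {x : S} (hx : x ∈ e.source) :
    Function.Injective (mfderiv I 𝓘(ℝ, E) (e.extend I) x) := by
  have hd : e.MDifferentiable I I :=
    ⟨(contMDiffOn_of_mem_maximalAtlas he).mdifferentiableOn hk,
      (contMDiffOn_symm_of_mem_maximalAtlas he).mdifferentiableOn hk⟩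
  have h := (I.hasMFDerivAt.comp x (hd.mdifferentiableAt hx).hasMFDerivAt).mfderiv
  have h2 : mfderiv I 𝓘(ℝ, E) (e.extend I) x = (ContinuousLinearMap.id ℝ E).comp _ := h
  rw [h2]
  exact hd.mfderiv_injective hx

/-- In suitable charts `g` is a linear inclusion into a product, so projecting to the first factor
recovers the source chart. The derivative of that chart is injective and factors through `dg`. -/
theorem Manifold.IsImmersionAt.injective_mfderiv [IsManifold I k S] [IsManifold J k X] (hk : k ≠ 0)
    {x : S} (h : IsImmersionAt I J k g x) : Function.Injective (mfderiv I J g x) := by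
  have hφ := injective_mfderiv_extend hk h.domChart_mem_maximalAtlas h.mem_domChart_source
  let A : E' →L[ℝ] E := (ContinuousLinearMap.fst ℝ E h.complement).comp
    (h.equiv.symm : E' →L[ℝ] E × h.complement)
  have heq : h.domChart.extend I =ᶠ[𝓝 x] (A ∘ h.codChart.extend J) ∘ g := by
    filter_upwards [h.domChart.open_source.mem_nhds h.mem_domChart_source] with y hy
    have h1 := h.writtenInCharts
      ((h.domChart.extend I).map_source (by rwa [OpenPartialHomeomorph.extend_source]))
    simp only [Function.comp_apply] at h1
    rw [(h.domChart.extend I).left_inv (by rwa [OpenPartialHomeomorph.extend_source])] at h1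
    change h.domChart.extend I y = (h.equiv.symm (h.codChart.extend J (g y))).1
    rw [h1]
    simp
  have hψ : MDifferentiableAt J 𝓘(ℝ, E') (h.codChart.extend J) (g x) :=
    (OpenPartialHomeomorph.contMDiffAt_extend h.codChart_mem_maximalAtlas
      h.mem_codChart_source).mdifferentiableAt hk
  have hg : MDifferentiableAt I J g x := h.contMDiffAt.mdifferentiableAt hk
  have hA : MDifferentiableAt 𝓘(ℝ, E') 𝓘(ℝ, E) A (h.codChart.extend J (g x)) :=
    A.mdifferentiableAt
  have hc : mfderiv I 𝓘(ℝ, E) (h.domChart.extend I) x =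
      (mfderiv J 𝓘(ℝ, E) (A ∘ h.codChart.extend J) (g x)).comp (mfderiv I J g x) :=
    heq.mfderiv_eq.trans (mfderiv_comp x (hA.comp _ hψ) hg)
  rw [hc] at hφ
  exact Function.Injective.of_comp hφ

theorem Manifold.IsSmoothEmbedding.injective_mfderiv [IsManifold I k S] [IsManifold J k X]
    (hk : k ≠ 0) (h : IsSmoothEmbedding I J k g) (x : S) :
    Function.Injective (mfderiv I J g x) :=
  (h.isImmersion.isImmersionAt x).injective_mfderiv hk

end Immersions

/-! ### Inward and outward vectors detected by extrema of a function -/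

section InwardVectors

variable {W : Type*} [TopologicalSpace W] [ChartedSpace (EuclideanHalfSpace 2) W]
  [IsManifold (𝓡∂ 2) 1 W]

theorem inwardComponent_eq (p : W) (v : TangentSpace (𝓡∂ 2) p) :
    inwardComponent p v = (show EuclideanSpace ℝ (Fin 2) from v) 0 := by
  unfold inwardComponent
  rw [mfderiv_extChartAt_self]
  rfl

/-- If a function on a surface takes its minimum at `p` and is increasing in the direction `v`,
then `v` points inward. -/
theorem inwardComponent_pos {f : W → ℝ} {p : W}
    (hf : MDifferentiableAt (𝓡∂ 2) 𝓘(ℝ, ℝ) f p) (hmin : ∀ w, f p ≤ f w)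
    {v : TangentSpace (𝓡∂ 2) p}
    {c : ℝ} (hc : 0 < c) (hv : mfderiv (𝓡∂ 2) 𝓘(ℝ, ℝ) f p v = c) : 0 < inwardComponent p v := by
  rw [inwardComponent_eq]
  by_contra! hle
  rw [hf.mfderiv] at hv
  have hD : HasFDerivWithinAt (writtenInExtChartAt (𝓡∂ 2) 𝓘(ℝ, ℝ) p f)
      (fderivWithin ℝ (writtenInExtChartAt (𝓡∂ 2) 𝓘(ℝ, ℝ) p f) (Set.range (𝓡∂ 2))
        (extChartAt (𝓡∂ 2) p p)) (Set.range (𝓡∂ 2)) (extChartAt (𝓡∂ 2) p p) :=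
    hf.differentiableWithinAt_writtenInExtChartAt.hasFDerivWithinAt
  have hmin' : IsLocalMinOn (writtenInExtChartAt (𝓡∂ 2) 𝓘(ℝ, ℝ) p f) (Set.range (𝓡∂ 2))
      (extChartAt (𝓡∂ 2) p p) := by
    refine Filter.Eventually.of_forall fun z => ?_
    simp only [writtenInExtChartAt, extChartAt_model_space_eq_id, Function.comp_apply,
      PartialEquiv.refl_coe, id, extChartAt_to_inv]
    exact hmin _
  have hrange : Set.range (𝓡∂ 2) = {y : EuclideanSpace ℝ (Fin 2) | 0 ≤ y 0} :=
    range_modelWithCornersEuclideanHalfSpace 2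
  -- If `v` were not inward, then `-v` would not leave the half plane. The first order condition at
  -- a minimum makes the derivative along `-v` nonnegative, but it equals `-c`.
  have hcone : -(show EuclideanSpace ℝ (Fin 2) from v) ∈
      posTangentConeAt (Set.range (𝓡∂ 2)) (extChartAt (𝓡∂ 2) p p) := by
    refine mem_posTangentConeAt_of_segment_subset ?_
    have hy : extChartAt (𝓡∂ 2) p p ∈ Set.range (𝓡∂ 2) := ⟨_, rfl⟩
    refine ((𝓡∂ 2).convex_range.segment_subset hy ?_)
    rw [hrange] at hy ⊢
    have hy' : 0 ≤ (extChartAt (𝓡∂ 2) p p) 0 := hy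
    change 0 ≤ (extChartAt (𝓡∂ 2) p p) 0 + -(show EuclideanSpace ℝ (Fin 2) from v) 0
    linarith
  have h1 := hmin'.hasFDerivWithinAt_nonneg hD hcone
  rw [map_neg] at h1
  have h2 : (0 : ℝ) ≤ -c := hv ▸ h1
  linarith

/-- If a function on a surface takes its maximum at `p` and is increasing in the direction `v`,
then `v` points outward. -/
theorem inwardComponent_neg {f : W → ℝ} {p : W}
    (hf : MDifferentiableAt (𝓡∂ 2) 𝓘(ℝ, ℝ) f p) (hmax : ∀ w, f w ≤ f p)
    {v : TangentSpace (𝓡∂ 2) p}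
    {c : ℝ} (hc : 0 < c) (hv : mfderiv (𝓡∂ 2) 𝓘(ℝ, ℝ) f p v = c) : inwardComponent p v < 0 := by
  have h1 : mfderiv (𝓡∂ 2) 𝓘(ℝ, ℝ) (fun w => -f w) p = -mfderiv (𝓡∂ 2) 𝓘(ℝ, ℝ) f p :=
    mfderiv_neg
  have h := inwardComponent_pos (f := fun w => -f w) (v := -v) hf.neg
    (fun w => neg_le_neg (hmax w)) hc (by
      have h2 : ∀ (D : EuclideanSpace ℝ (Fin 2) →L[ℝ] ℝ) (w : EuclideanSpace ℝ (Fin 2)),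
          (-D) (-w) = D w := by simp
      rw [h1]
      exact (h2 _ _).trans hv)
  rw [inwardComponent_eq] at h ⊢
  have h2 : (0 : ℝ) < -(show EuclideanSpace ℝ (Fin 2) from v) 0 := h
  linarith

end InwardVectors

/-! ### Sections of the spin structure; existence and uniqueness of the induced framing -/

section SpinFrames

set_option linter.unusedSectionVars false

open Bundle

variable {n : ℕ} {M : Type u} [TopologicalSpace M]
  [ChartedSpace (EuclideanSpace ℝ (Fin (n + 1))) M] [IsManifold (𝓡 (n + 1)) ∞ M]
  {o : TangentOrientation n M}

/-- The vectors of the frame underlying an element of a spin structure. -/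
noncomputable def SpinStructure.frame (σ : SpinStructure o) (p : σ.P) (i : Fin (n + 1)) :
    EuclideanSpace ℝ (Fin (n + 1)) :=
  (σ.proj p).1.2 i

theorem SpinStructure.mk_frame (σ : SpinStructure o) {p : σ.P} {x : M} (h : σ.base p = x)
    (i : Fin (n + 1)) :
    (⟨x, σ.frame p i⟩ : TangentBundle (𝓡 (n + 1)) M) = (σ.proj p).1.vec i := by
  subst h
  rfl

theorem SpinStructure.linearIndependent_frame (σ : SpinStructure o) (p : σ.P) :
    LinearIndependent ℝ (σ.frame p) :=
  (σ.proj p).1.2.linearIndependent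

theorem SpinStructure.continuous_frame (σ : SpinStructure o) {B : Type*} [TopologicalSpace B]
    {q : B → σ.P} (hq : Continuous q) {x : B → M} (hx : ∀ b, σ.base (q b) = x b)
    (i : Fin (n + 1)) :
    Continuous fun b => (⟨x b, σ.frame (q b) i⟩ : TangentBundle (𝓡 (n + 1)) M) := by
  simp only [fun b => σ.mk_frame (hx b) i]
  exact (FrameBundle.continuous_vec i).comp
    (continuous_subtype_val.comp (σ.isCoveringMap.continuous.comp hq))

theorem finrank_euclidean_eq (k r : ℕ) :
    Module.finrank ℝ (EuclideanSpace ℝ (Fin (r + k))) =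
      Module.finrank ℝ (EuclideanSpace ℝ (Fin k)) + r := by
  rw [finrank_euclideanSpace_fin, finrank_euclideanSpace_fin, add_comm]

/-- An equality in the total space contains an equality of base points, already visible at index
`0`. Splitting it off leaves an equality of vectors in one fibre, the form used by
`NormalTriv.MapsTo`. -/
theorem isInducedStableFraming_iff (σ : SpinStructure o)
    (X : NormallyFramedSubmanifold (n := n) M) (Φ : StableFraming (𝓡 1) X.C.carrier 1) :
    IsInducedStableFraming σ X Φ ↔
      ∃ (q : X.C.carrier → σ.P) (ν : NormalTriv (𝓡 1) (𝓡 (n + 1)) X.emb n)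
        (s : StableTriv (𝓡 1) X.C.carrier 1 n), Continuous q ∧
        (∀ x, σ.base (q x) = X.emb x) ∧ ν.framing = X.framing ∧ s.framing = Φ ∧
        ν.MapsTo s fun i x => σ.frame (q x) i := by
  constructor
  · rintro ⟨q, ν, s, hq, hν, hs, h⟩
    have hb : ∀ x, σ.base (q x) = X.emb x := fun x =>
      (congrArg TotalSpace.proj (h 0 x)).symm
    refine ⟨q, ν, s, hq, hb, hν, hs, fun i x => ?_⟩
    have h1 := (h i x).trans (σ.mk_frame (hb x) i).symm
    exact eq_of_heq (TotalSpace.mk.inj h1).2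
  · rintro ⟨q, ν, s, hq, hb, hν, hs, h⟩
    refine ⟨q, ν, s, hq, hν, hs, fun i x => ?_⟩
    exact (congrArg (TotalSpace.mk (X.emb x)) (h i x)).trans (σ.mk_frame (hb x) i)

/-- The two sections define a lift near the ends of the cylinder, and simply connected fibres allow
it to be extended over the middle. -/
theorem SpinStructure.exists_section_cylinder (σ : SpinStructure o) (C : ClosedOneManifold.{u})
    {g : C.carrier → M} (hg : Continuous g) {q q' : C.carrier → σ.P} (hq : Continuous q)
    (hq' : Continuous q') (hqg : ∀ x, σ.base (q x) = g x) (hqg' : ∀ x, σ.base (q' x) = g x) :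
    ∃ Q : unitInterval × C.carrier → σ.P, Continuous Q ∧ (∀ p, σ.base (Q p) = g p.2) ∧
      (∀ x, Q (0, x) = q x) ∧ ∀ x, Q (1, x) = q' x := by
  classical
  have hc : Continuous fun p : unitInterval × C.carrier => (p.1 : ℝ) := by fun_prop
  let f : unitInterval × C.carrier → σ.P := fun p => if (p.1 : ℝ) < 1 / 2 then q p.2 else q' p.2
  have hO₁ : IsOpen {p : unitInterval × C.carrier | (p.1 : ℝ) < 1 / 2} :=
    isOpen_lt hc continuous_const
  have hO₂ : IsOpen {p : unitInterval × C.carrier | 1 / 2 < (p.1 : ℝ)} :=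
    isOpen_lt continuous_const hc
  have hf : ContinuousOn f ({p | (p.1 : ℝ) < 1 / 2} ∪ {p | 1 / 2 < (p.1 : ℝ)}) := by
    refine ContinuousOn.union_of_isOpen ?_ ?_ hO₁ hO₂
    · exact (hq.comp continuous_snd).continuousOn.congr fun p hp => if_pos hp
    · exact (hq'.comp continuous_snd).continuousOn.congr fun p hp => if_neg (not_lt.2 (le_of_lt hp))
  obtain ⟨Q, hQ, hQg, hQf⟩ := σ.hasSimplyConnectedLocalModels.exists_lift
    (hasSquareNhds_cylinder C.carrier) (g := fun p => g p.2) (hg.comp continuous_snd)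
    (A := {p | (p.1 : ℝ) = 0} ∪ {p | (p.1 : ℝ) = 1})
    ((isClosed_eq hc continuous_const).union (isClosed_eq hc continuous_const))
    (hO₁.union hO₂) (by
      rintro p (hp | hp)
      · exact Or.inl (by rw [Set.mem_ofPred_eq] at hp ⊢; rw [hp]; norm_num)
      · exact Or.inr (by rw [Set.mem_ofPred_eq] at hp ⊢; rw [hp]; norm_num))
    hf (by
      intro p _
      unfold f
      split_ifs
      · exact hqg _
      · exact hqg' _)
  refine ⟨Q, hQ, hQg, fun x => ?_, fun x => ?_⟩
  · rw [hQf (Or.inl rfl)]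
    exact if_pos (by norm_num)
  · rw [hQf (Or.inr rfl)]
    exact if_neg (by norm_num)

theorem SpinStructure.exists_section [Nonempty M] (σ : SpinStructure o) {W : Type*}
    [TopologicalSpace W] [CompactSpace W] [T2Space W] (hW : HasSquareNhds W) {g : W → M}
    (hg : Continuous g) : ∃ q : W → σ.P, Continuous q ∧ ∀ x, σ.base (q x) = g x := by
  obtain ⟨m⟩ := ‹Nonempty M›
  have := σ.simplyConnected m
  obtain ⟨p⟩ := (inferInstance : Nonempty {p : σ.P // (σ.proj p).1.1 = m})
  obtain ⟨q, hq, hqg, -⟩ := σ.hasSimplyConnectedLocalModels.exists_lift hW hg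
    isClosed_empty isOpen_empty (Set.empty_subset _) (f := fun _ => p.1) (continuousOn_empty _)
    (by simp)
  exact ⟨q, hq, hqg⟩

/-- The lifting theorem concerns surfaces, so a section is taken over the cylinder and restricted to
one end. -/
theorem SpinStructure.exists_section_oneManifold [Nonempty M] (σ : SpinStructure o)
    (C : ClosedOneManifold.{u}) {g : C.carrier → M} (hg : Continuous g) :
    ∃ q : C.carrier → σ.P, Continuous q ∧ ∀ x, σ.base (q x) = g x := by
  obtain ⟨Q, hQ, hQg⟩ := σ.exists_section (hasSquareNhds_cylinder C.carrier)
    (g := fun p => g p.2) (hg.comp continuous_snd)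
  exact ⟨fun x => Q (0, x), hQ.comp (by fun_prop), fun x => hQg (0, x)⟩

theorem NormallyFramedSubmanifold.injective_mfderiv (X : NormallyFramedSubmanifold (n := n) M)
    (x : X.C.carrier) : Function.Injective (mfderiv (𝓡 1) (𝓡 (n + 1)) X.emb x) :=
  X.isSmoothEmbedding_emb.injective_mfderiv (by simp) x

theorem NormallyFramedSubmanifold.contMDiff (X : NormallyFramedSubmanifold (n := n) M) :
    ContMDiff (𝓡 1) (𝓡 (n + 1)) 1 X.emb :=
  X.isSmoothEmbedding_emb.contMDiff.of_le (by simp)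

theorem exists_isInducedStableFraming [Nonempty M] (σ : SpinStructure o)
    (X : NormallyFramedSubmanifold (n := n) M) : ∃ Φ, IsInducedStableFraming σ X Φ := by
  obtain ⟨q, hq, hqX⟩ := σ.exists_section_oneManifold X.C X.contMDiff.continuous
  obtain ⟨ν, hν⟩ : ∃ ν : NormalTriv (𝓡 1) (𝓡 (n + 1)) X.emb n, ν.framing = X.framing :=
    Quot.exists_rep X.framing
  obtain ⟨s, hs⟩ := ν.exists_mapsTo (d := 1) X.contMDiff X.injective_mfderiv
    (finrank_euclidean_eq 1 n)
    (e := fun i x => σ.frame (q x) i) (σ.continuous_frame hq hqX)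
    fun x => σ.linearIndependent_frame (q x)
  exact ⟨s.framing, (isInducedStableFraming_iff σ X _).2 ⟨q, ν, s, hq, hqX, hν, rfl, hs⟩⟩

theorem IsInducedStableFraming.unique {σ : SpinStructure o}
    {X : NormallyFramedSubmanifold (n := n) M} {Φ Φ' : StableFraming (𝓡 1) X.C.carrier 1}
    (h : IsInducedStableFraming σ X Φ) (h' : IsInducedStableFraming σ X Φ') : Φ = Φ' := by
  rw [isInducedStableFraming_iff] at h h'
  obtain ⟨q, ν, s, hq, hqX, hν, rfl, hs⟩ := h
  obtain ⟨q', ν', s', hq', hqX', hν', rfl, hs'⟩ := h'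
  obtain ⟨Q, hQ, hQX, hQ0, hQ1⟩ :=
    σ.exists_section_cylinder X.C X.contMDiff.continuous hq hq' hqX hqX'
  have hrank := finrank_euclidean_eq 1 n
  obtain ⟨s'', hs''⟩ := ν.exists_mapsTo (d := 1) X.contMDiff X.injective_mfderiv hrank
    (e := fun i x => σ.frame (q' x) i) (σ.continuous_frame hq' hqX')
    fun x => σ.linearIndependent_frame (q' x)
  -- Change one datum at a time: here the section moves from `q` to `q'` with `ν` fixed, afterwards
  -- `ν` is replaced by `ν'` with `q'` fixed.
  have h1 : s.framing = s''.framing := by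
    refine StableTriv.framing_eq_of_homotopic (NormalTriv.MapsTo.homotopic X.contMDiff
      X.injective_mfderiv hrank (ν := fun _ => ν) (e := fun t i x => σ.frame (Q (t, x)) i)
      (fun j => (ν.continuous_vec j).comp continuous_snd) (σ.continuous_frame hQ hQX)
      (fun t x => σ.linearIndependent_frame _) ?_ ?_)
    · simpa only [hQ0] using hs
    · simpa only [hQ1] using hs''
  rw [h1]
  exact NormalTriv.MapsTo.framing_eq X.contMDiff X.injective_mfderiv hrank
    (σ.continuous_frame hq' hqX') (fun x => σ.linearIndependent_frame (q' x))
    (hν.trans hν'.symm) hs'' hs'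

end SpinFrames

/-! ### Restricting the trivialization over a bordism to its boundary -/

section BoundaryRestriction

set_option linter.unusedSectionVars false

open Bundle

variable {n : ℕ} {M : Type u} [TopologicalSpace M]
  [ChartedSpace (EuclideanSpace ℝ (Fin (n + 1))) M] [IsManifold (𝓡 (n + 1)) ∞ M]
  {o : TangentOrientation n M}

/-- A continuous vector field along a map to `M × ℝ`, given by its components. -/
theorem continuous_prod_field {B : Type*} [TopologicalSpace B] {y : B → M} {c : B → ℝ}
    {v : ∀ b, TangentSpace (𝓡 (n + 1)) (y b)} {a : B → ℝ}
    (hv : Continuous fun b => (⟨y b, v b⟩ : TangentBundle (𝓡 (n + 1)) M)) (hc : Continuous c)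
    (ha : Continuous a) :
    Continuous fun b => (⟨(y b, c b), (v b, a b)⟩ :
      TangentBundle ((𝓡 (n + 1)).prod 𝓘(ℝ, ℝ)) (M × ℝ)) := by
  have h1 : Continuous fun b => (⟨c b, a b⟩ : TangentBundle 𝓘(ℝ, ℝ) ℝ) :=
    (tangentBundleModelSpaceHomeomorph 𝓘(ℝ, ℝ)).symm.continuous.comp (hc.prodMk ha)
  exact (contMDiff_equivTangentBundleProd_symm (n := 0) (I := 𝓡 (n + 1)) (I' := 𝓘(ℝ, ℝ)) (M := M)
    (M' := ℝ)).continuous.comp (hv.prodMk h1)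

/-- The frame of `M × ℝ` along a map consisting of the frame of `M` underlying an element of the
spin structure and of the unit vector field of `ℝ`. -/
noncomputable def SpinStructure.cylinderFrame (σ : SpinStructure o) (p : σ.P)
    (i : Fin (n + 1 + 1)) : EuclideanSpace ℝ (Fin (n + 1)) × ℝ :=
  if h : (i : ℕ) < n + 1 then (σ.frame p ⟨i, h⟩, 0) else (0, 1)

theorem SpinStructure.cylinderFrame_castSucc (σ : SpinStructure o) (p : σ.P) (i : Fin (n + 1)) :
    σ.cylinderFrame p i.castSucc = (σ.frame p i, 0) :=
  dif_pos i.2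

theorem SpinStructure.cylinderFrame_last (σ : SpinStructure o) (p : σ.P) :
    σ.cylinderFrame p (Fin.last (n + 1)) = (0, 1) := by
  simp [SpinStructure.cylinderFrame]

theorem SpinStructure.linearIndependent_cylinderFrame (σ : SpinStructure o) (p : σ.P) :
    LinearIndependent ℝ (σ.cylinderFrame p) := by
  rw [Fintype.linearIndependent_iff]
  intro c hc
  rw [Fin.sum_univ_castSucc] at hc
  simp only [σ.cylinderFrame_castSucc, σ.cylinderFrame_last] at hc
  have h1 := congrArg Prod.fst hc
  have h2 := congrArg Prod.snd hc
  simp only [Prod.fst_add, Prod.fst_sum, Prod.smul_fst, smul_zero, add_zero, Prod.fst_zero] at h1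
  simp [Prod.snd_sum] at h2
  have h3 := Fintype.linearIndependent_iff.1 (σ.linearIndependent_frame p) _ h1
  intro i
  refine Fin.lastCases h2 (fun i => h3 i) i

theorem SpinStructure.continuous_cylinderFrame (σ : SpinStructure o) {B : Type*}
    [TopologicalSpace B] {q : B → σ.P} (hq : Continuous q) {x : B → M × ℝ} (hxc : Continuous x)
    (hx : ∀ b, σ.base (q b) = (x b).1) (i : Fin (n + 1 + 1)) :
    Continuous fun b => (⟨x b, σ.cylinderFrame (q b) i⟩ :
      TangentBundle ((𝓡 (n + 1)).prod 𝓘(ℝ, ℝ)) (M × ℝ)) := by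
  refine Fin.lastCases ?_ (fun i => ?_) i
  · simp only [σ.cylinderFrame_last]
    have h : Continuous fun b => (⟨(x b).1, 0⟩ : TangentBundle (𝓡 (n + 1)) M) :=
      (Trivialization.continuous_zeroSection ℝ (F := EuclideanSpace ℝ (Fin (n + 1)))
        (E := (TangentSpace (𝓡 (n + 1)) : M → Type _))).comp (continuous_fst.comp hxc)
    exact continuous_prod_field h (continuous_snd.comp hxc) continuous_const
  · simp only [σ.cylinderFrame_castSucc]
    exact continuous_prod_field (σ.continuous_frame hq hx i) (continuous_snd.comp hxc)
      continuous_const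

theorem finrank_prod_real (k r : ℕ) :
    Module.finrank ℝ (EuclideanSpace ℝ (Fin (r + k)) × ℝ) =
      Module.finrank ℝ (EuclideanSpace ℝ (Fin k)) + (r + 1) := by
  rw [Module.finrank_prod, finrank_euclideanSpace_fin, finrank_euclideanSpace_fin,
    Module.finrank_self]
  ring

/-- The two derivatives take values in tangent spaces at formally different points; comparing them
in the model space `E'` avoids transport between these types. -/
theorem mfderiv_eq_of_eq {E H E' H' : Type*} [NormedAddCommGroup E] [NormedSpace ℝ E]
    [TopologicalSpace H] {I : ModelWithCorners ℝ E H} [NormedAddCommGroup E'] [NormedSpace ℝ E']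
    [TopologicalSpace H'] {J : ModelWithCorners ℝ E' H'} {S X : Type*} [TopologicalSpace S]
    [ChartedSpace H S] [TopologicalSpace X] [ChartedSpace H' X] {g g' : S → X} (h : g = g') (x : S)
    (v : TangentSpace I x) : @Eq E' (mfderiv I J g x v) (mfderiv I J g' x v) := by
  subst h
  rfl

/-- Normal trivializations built from `k` fields `y` and one further field `z`. -/
theorem exists_normalTriv_snoc {E H E' H' : Type*} [NormedAddCommGroup E] [NormedSpace ℝ E]
    [TopologicalSpace H] {I : ModelWithCorners ℝ E H} [NormedAddCommGroup E'] [NormedSpace ℝ E']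
    [TopologicalSpace H'] {J : ModelWithCorners ℝ E' H'} {S X T : Type*} [TopologicalSpace S]
    [ChartedSpace H S] [TopologicalSpace X] [ChartedSpace H' X] [IsManifold J 1 X]
    [TopologicalSpace T] {g : S → X} {k : ℕ} (y : T → Fin k → S → E') (z : T → S → E')
    (hy : ∀ j, Continuous fun p : T × S => (⟨g p.2, y p.1 j p.2⟩ : TangentBundle J X))
    (hz : Continuous fun p : T × S => (⟨g p.2, z p.1 p.2⟩ : TangentBundle J X))
    (hli : ∀ t x (c : Fin k → ℝ) (c' : ℝ) (v : TangentSpace I x),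
      @Eq E' (mfderiv I J g x v) (∑ j, c j • y t j x + c' • z t x) → c = 0 ∧ c' = 0) :
    ∃ μ : T → NormalTriv I J g (k + 1),
      (∀ j, Continuous fun p : T × S => (⟨g p.2, (μ p.1).vec j p.2⟩ : TangentBundle J X)) ∧
      (∀ t j x, (μ t).vec (Fin.castSucc j) x = y t j x) ∧
      ∀ t x, (μ t).vec (Fin.last k) x = z t x := by
  let w : T → Fin (k + 1) → S → E' := fun t => Fin.snoc (α := fun _ => S → E') (y t) (z t)
  have hw1 : ∀ t j, w t (Fin.castSucc j) = y t j := fun t j => Fin.snoc_castSucc (α := fun _ => S → E') ..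
  have hw2 : ∀ t, w t (Fin.last k) = z t := fun t => Fin.snoc_last (α := fun _ => S → E') ..
  have hw : ∀ j, Continuous fun p : T × S => (⟨g p.2, w p.1 j p.2⟩ : TangentBundle J X) := by
    intro j
    refine Fin.lastCases ?_ (fun j => ?_) j
    · simpa only [hw2] using hz
    · simpa only [hw1] using hy j
  let w' : T → Fin (k + 1) → ∀ x, TangentSpace J (g x) := fun t j x => w t j x
  refine ⟨fun t => ⟨w' t, fun j => (hw j).comp (Continuous.prodMk_right t), ?_⟩,
    hw, fun t j x => congrFun (hw1 t j) x, fun t x => congrFun (hw2 t) x⟩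
  intro x
  rw [Fintype.linearIndependent_iff]
  intro c hc
  simp only [← map_smul, ← map_sum] at hc
  rw [Submodule.mkQ_apply, Submodule.Quotient.mk_eq_zero] at hc
  obtain ⟨v, hv⟩ := hc
  have hv' : @Eq E' (mfderiv I J g x v) (∑ j, c j • w t j x) := hv
  rw [Fin.sum_univ_castSucc] at hv'
  simp only [hw1, hw2] at hv'
  obtain ⟨h1, h2⟩ := hli t x _ _ v hv'
  intro j
  exact Fin.lastCases h2 (fun j => congrFun h1 j) j

/-- The map `(v, a) ↦ dg(v) + ∑ a_j ν_j` for a normal trivialization with a distinguished last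
vector. -/
theorem NormalTriv.splitting_eq_of_snoc {E H E' H' : Type*} [NormedAddCommGroup E]
    [NormedSpace ℝ E] [TopologicalSpace H] {I : ModelWithCorners ℝ E H} [NormedAddCommGroup E']
    [NormedSpace ℝ E'] [TopologicalSpace H'] {J : ModelWithCorners ℝ E' H'} {S X : Type*}
    [TopologicalSpace S] [ChartedSpace H S] [TopologicalSpace X] [ChartedSpace H' X]
    [IsManifold J 1 X] [IsManifold I 1 S] {g : S → X} {k : ℕ} (μ : NormalTriv I J g (k + 1)) {x : S} {y : Fin k → E'}
    {z : E'} (hy : ∀ j, @Eq E' (μ.vec (Fin.castSucc j) x) (y j))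
    (hz : @Eq E' (μ.vec (Fin.last k) x) z) {v : TangentSpace I x} {v' : E'}
    (hv : @Eq E' (mfderiv I J g x v) v') (α : Fin (k + 1) → ℝ) :
    @Eq E' (μ.splitting x (v, α)) (v' + (∑ j, α (Fin.castSucc j) • y j + α (Fin.last k) • z)) := by
  subst hv hz
  obtain rfl : y = fun j => μ.vec (Fin.castSucc j) x := funext fun j => (hy j).symm
  rw [μ.splitting_apply, Fin.sum_univ_castSucc]
  rfl

theorem NormalTriv.ext_vec {E H E' H' : Type*} [NormedAddCommGroup E] [NormedSpace ℝ E]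
    [TopologicalSpace H] {I : ModelWithCorners ℝ E H} [NormedAddCommGroup E'] [NormedSpace ℝ E']
    [TopologicalSpace H'] {J : ModelWithCorners ℝ E' H'} {S X : Type*} [TopologicalSpace S]
    [ChartedSpace H S] [TopologicalSpace X] [ChartedSpace H' X] [IsManifold J 1 X]
    {g : S → X} {k : ℕ} {ν ν' : NormalTriv I J g k} (h : ∀ j x, ν.vec j x = ν'.vec j x) :
    ν = ν' := by
  cases ν
  cases ν'
  congr
  funext j x
  exact h j x

theorem tangentBundle_mk_congr {E' H' : Type*} [NormedAddCommGroup E'] [NormedSpace ℝ E']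
    [TopologicalSpace H'] {J : ModelWithCorners ℝ E' H'} {X : Type*} [TopologicalSpace X]
    [ChartedSpace H' X] {x y : X} (h : x = y) (v : E') :
    (⟨x, v⟩ : TangentBundle J X) = ⟨y, v⟩ := by
  subst h
  rfl

section

variable {C W : Type u} [TopologicalSpace C] [ChartedSpace (EuclideanSpace ℝ (Fin 1)) C]
  [IsManifold (𝓡 1) ∞ C] [TopologicalSpace W] [ChartedSpace (EuclideanHalfSpace 2) W]
  [IsManifold (𝓡∂ 2) ∞ W] {ι : C → M} {t₀ : ℝ} {b : C → W} {F : W → M × ℝ}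

/-- The derivative of a boundary inclusion, seen in `M × ℝ`. -/
theorem mfderiv_comp_boundary (hι : ContMDiff (𝓡 1) (𝓡 (n + 1)) 1 ι)
    (hFb : ∀ x, F (b x) = (ι x, t₀)) (x : C) (v : TangentSpace (𝓡 1) x) :
    @Eq (EuclideanSpace ℝ (Fin (n + 1)) × ℝ)
      (mfderiv (𝓡 1) ((𝓡 (n + 1)).prod 𝓘(ℝ, ℝ)) (F ∘ b) x v)
      (mfderiv (𝓡 1) (𝓡 (n + 1)) ι x v, 0) := by
  refine (mfderiv_eq_of_eq (g' := fun x => (ι x, t₀)) (funext hFb) x v).trans ?_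
  have h := mfderiv_prodMk (I := 𝓡 1) (I' := 𝓡 (n + 1)) (I'' := 𝓘(ℝ, ℝ))
    (hι.mdifferentiable one_ne_zero x) (mdifferentiableAt_const (c := t₀))
  rw [mfderiv_const] at h
  exact congrArg (fun (A : EuclideanSpace ℝ (Fin 1) →L[ℝ] EuclideanSpace ℝ (Fin (n + 1)) × ℝ) =>
    A v) h

/-- The condition on normal framings at the boundary, in terms of vectors of `ℝ^(n+1) × ℝ`. -/
theorem IsNormalRestriction.exists_eq {ν : NormalTriv (𝓡∂ 2) ((𝓡 (n + 1)).prod 𝓘(ℝ, ℝ)) F n}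
    {ν₀ : NormalTriv (𝓡 1) (𝓡 (n + 1)) ι n} (h : IsNormalRestriction ι t₀ b F ν ν₀)
    (j : Fin n) (x : C) : ∃ v : TangentSpace (𝓡∂ 2) (b x),
      @Eq (EuclideanSpace ℝ (Fin (n + 1)) × ℝ)
        (ν.vec j (b x) + mfderiv (𝓡∂ 2) ((𝓡 (n + 1)).prod 𝓘(ℝ, ℝ)) F (b x) v)
        (ν₀.vec j x, 0) := by
  obtain ⟨v, hv⟩ := h j x
  refine ⟨v, (eq_of_heq (TotalSpace.mk.inj hv).2).trans ?_⟩
  rw [mfderiv_prod_left]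
  rfl

/-- Let the surface `F : W → M × ℝ` with normal trivialization `ν` and boundary `ι : C → M` be such
that `ν` restricts to `ν₀`, and let `ψ` be the trivialization of `TW ⊕ ε^n` given by `ν` and a
section of the spin structure. Then `ψ` restricts to a trivialization over `C` in the stable framing
given by `ν₀` and the section. -/
theorem exists_isBoundaryRestriction (σ : SpinStructure o)
    (hι : IsSmoothEmbedding (𝓡 1) (𝓡 (n + 1)) ∞ ι) (hb : IsSmoothEmbedding (𝓡 1) (𝓡∂ 2) ∞ b)
    (hF : IsSmoothEmbedding (𝓡∂ 2) ((𝓡 (n + 1)).prod 𝓘(ℝ, ℝ)) ∞ F)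
    (hFb : ∀ x, F (b x) = (ι x, t₀))
    {ν : NormalTriv (𝓡∂ 2) ((𝓡 (n + 1)).prod 𝓘(ℝ, ℝ)) F n}
    {ν₀ : NormalTriv (𝓡 1) (𝓡 (n + 1)) ι n} (h : IsNormalRestriction ι t₀ b F ν ν₀)
    {q : W → σ.P} (hq : Continuous q) (hqF : ∀ w, σ.base (q w) = (F w).1)
    {ψ : StableTriv (𝓡∂ 2) W 2 n} (hψ : ν.MapsTo ψ fun i w => σ.cylinderFrame (q w) i) :
    ∃ (N : ∀ x, TangentSpace (𝓡∂ 2) (b x)) (s : StableTriv (𝓡 1) C 1 (n + 1)),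
      Continuous (fun x => (⟨b x, N x⟩ : TangentBundle (𝓡∂ 2) W)) ∧
      (∀ x, mfderiv (𝓡∂ 2) 𝓘(ℝ, ℝ) (fun w => (F w).2) (b x) (N x) = (1 : ℝ)) ∧
      IsBoundaryRestriction b N ψ s ∧
      ∀ s₀ : StableTriv (𝓡 1) C 1 n, ν₀.MapsTo s₀ (fun i x => σ.frame (q (b x)) i) →
        s.framing = s₀.framing := by
  have hbM : ContMDiff (𝓡 1) (𝓡∂ 2) 1 b := hb.contMDiff.of_le (by simp)
  have hιM : ContMDiff (𝓡 1) (𝓡 (n + 1)) 1 ι := hι.contMDiff.of_le (by simp)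
  have hFM : ContMDiff (𝓡∂ 2) ((𝓡 (n + 1)).prod 𝓘(ℝ, ℝ)) 1 F := hF.contMDiff.of_le (by simp)
  have hGM : ContMDiff (𝓡 1) ((𝓡 (n + 1)).prod 𝓘(ℝ, ℝ)) 1 (F ∘ b) := hFM.comp hbM
  have hFinj := hF.injective_mfderiv (by simp)
  have hcont : Continuous fun x => F (b x) := hGM.continuous
  have hcomp : ∀ x (v : TangentSpace (𝓡 1) x),
      mfderiv (𝓡 1) ((𝓡 (n + 1)).prod 𝓘(ℝ, ℝ)) (F ∘ b) x v =
        mfderiv (𝓡∂ 2) ((𝓡 (n + 1)).prod 𝓘(ℝ, ℝ)) F (b x) (mfderiv (𝓡 1) (𝓡∂ 2) b x v) := by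
    intro x v
    exact mfderiv_comp_apply x (hFM.mdifferentiable one_ne_zero _)
      (hbM.mdifferentiable one_ne_zero _) v
  have hGinj : ∀ x, Function.Injective
      (mfderiv (𝓡 1) ((𝓡 (n + 1)).prod 𝓘(ℝ, ℝ)) (F ∘ b) x) := by
    intro x v v' hv
    rw [hcomp, hcomp] at hv
    exact hb.injective_mfderiv (by simp) x (hFinj _ hv)
  have hGι := mfderiv_comp_boundary (n := n) (F := F) hιM hFb
  -- all vectors tangent to `M × ℝ` are regarded as vectors of `ℝ^(n+1) × ℝ`
  let D : ∀ x : C, EuclideanSpace ℝ (Fin 2) →L[ℝ] EuclideanSpace ℝ (Fin (n + 1)) × ℝ :=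
    fun x => mfderiv (𝓡∂ 2) ((𝓡 (n + 1)).prod 𝓘(ℝ, ℝ)) F (b x)
  let V : Fin n → C → EuclideanSpace ℝ (Fin (n + 1)) × ℝ := fun j x => ν.vec j (b x)
  let V₀ : Fin n → C → EuclideanSpace ℝ (Fin (n + 1)) × ℝ := fun j x => (ν₀.vec j x, 0)
  have hres := fun j x => h.exists_eq (n := n) j x
  choose u hu using hres
  have hu' : ∀ j x, D x (u j x) = V₀ j x - V j x := fun j x => eq_sub_of_add_eq' (hu j x)
  have hVc : ∀ j, Continuous fun x => (⟨F (b x), V j x⟩ :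
      TangentBundle ((𝓡 (n + 1)).prod 𝓘(ℝ, ℝ)) (M × ℝ)) := fun j =>
    (ν.continuous_vec j).comp hbM.continuous
  have hV₀c : ∀ j, Continuous fun x => (⟨F (b x), V₀ j x⟩ :
      TangentBundle ((𝓡 (n + 1)).prod 𝓘(ℝ, ℝ)) (M × ℝ)) := fun j => by
    have h1 := continuous_prod_field (c := fun _ => t₀) (a := fun _ => 0) (ν₀.continuous_vec j)
      continuous_const continuous_const
    refine h1.congr fun x => ?_
    exact (tangentBundle_mk_congr (hFb x) (V₀ j x)).symm
  have hrankF : Module.finrank ℝ (EuclideanSpace ℝ (Fin (n + 1)) × ℝ) =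
      Module.finrank ℝ (EuclideanSpace ℝ (Fin 2)) + n := by
    rw [finrank_prod_real, finrank_euclideanSpace_fin, finrank_euclideanSpace_fin]
    ring
  -- The corrections `u` were chosen pointwise, but they are solutions of `dF(u) = V₀ - V` with
  -- continuous right side, so the splitting of `ν` makes them continuous.
  have huc : ∀ j, Continuous fun x => (⟨b x, u j x⟩ : TangentBundle (𝓡∂ 2) W) := by
    intro j
    refine (NormalTriv.continuous_of_splitting (ν := fun _ : C => ν) (w := fun x => (u j x, 0))
      hbM.continuous hFM hFinj hrankF hVc ?_).1
    have h1 : ∀ x, ν.splitting (b x) (u j x, 0) = (V₀ j x + (-1 : ℝ) • V j x) := by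
      intro x
      rw [ν.splitting_apply]
      simp only [Pi.zero_apply, zero_smul, Finset.sum_const_zero, add_zero]
      refine (hu' j x).trans ?_
      rw [neg_one_smul, sub_eq_add_neg]
    simp only [h1]
    exact continuous_iff_continuousAt.2 fun x => ContinuousAt.bundle_add (hV₀c j).continuousAt
      (ContinuousAt.bundle_smul continuousAt_const (hVc j).continuousAt)
  -- the normal field of the boundary
  let a : C → Fin n → ℝ := fun x => (ψ.vec (Fin.last (n + 1)) (b x)).2
  have hac : Continuous a := (ψ.continuous_snd _).comp hbM.continuous
  -- The last vector of `ψ` expresses `∂_t` as a tangent vector plus `∑ a_j V_j`. Subtracting `∑ a_j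
  -- u_j` trades each `V_j` for `V₀_j`, so `N` is sent to `∂_t - ∑ a_j V₀_j`, of height one since
  -- the `V₀_j` are horizontal.
  let N : ∀ x, TangentSpace (𝓡∂ 2) (b x) := fun x =>
    (ψ.vec (Fin.last (n + 1)) (b x)).1 + ∑ j, (-a x j) • u j x
  have hNc : Continuous fun x => (⟨b x, N x⟩ : TangentBundle (𝓡∂ 2) W) := by
    refine continuous_iff_continuousAt.2 fun x => ContinuousAt.bundle_add
      ((ψ.continuous_fst _).comp hbM.continuous).continuousAt
      (ContinuousAt.bundle_sum _ hbM.continuous.continuousAt fun j =>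
        ContinuousAt.bundle_smul ?_ (huc j).continuousAt)
    exact ((continuous_apply j).comp hac).neg.continuousAt
  have hDN : ∀ x, D x (N x) = (0, 1) + -∑ j, a x j • V₀ j x := by
    intro x
    have h1 : D x (ψ.vec (Fin.last (n + 1)) (b x)).1 + ∑ j, a x j • V j x = (0, 1) :=
      (hψ (Fin.last (n + 1)) (b x)).trans (σ.cylinderFrame_last _)
    have h2 : D x (N x) = D x (ψ.vec (Fin.last (n + 1)) (b x)).1 +
        ∑ j, (-a x j) • D x (u j x) := by
      have h3 : ∀ (A : EuclideanSpace ℝ (Fin 2) →L[ℝ] EuclideanSpace ℝ (Fin (n + 1)) × ℝ)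
          (v : EuclideanSpace ℝ (Fin 2)) (c : Fin n → ℝ) (w : Fin n → EuclideanSpace ℝ (Fin 2)),
          A (v + ∑ j, c j • w j) = A v + ∑ j, c j • A (w j) := by
        intro A v c w
        simp
      exact h3 _ _ _ _
    rw [h2, ← h1]
    simp only [hu', neg_smul, smul_sub, Finset.sum_neg_distrib, Finset.sum_sub_distrib]
    abel
  have hDN2 : ∀ x, (D x (N x)).2 = 1 := by
    intro x
    rw [hDN]
    simp [V₀, Prod.snd_sum]
  have hG : ∀ x (v : TangentSpace (𝓡 1) x), @Eq (EuclideanSpace ℝ (Fin (n + 1)) × ℝ)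
      (mfderiv (𝓡 1) ((𝓡 (n + 1)).prod 𝓘(ℝ, ℝ)) (F ∘ b) x v)
      (D x (mfderiv (𝓡 1) (𝓡∂ 2) b x v)) := hcomp
  have hDc : ∀ {v : ∀ x, TangentSpace (𝓡∂ 2) (b x)},
      (Continuous fun x => (⟨b x, v x⟩ : TangentBundle (𝓡∂ 2) W)) →
      Continuous fun x => (⟨F (b x), D x (v x)⟩ :
        TangentBundle ((𝓡 (n + 1)).prod 𝓘(ℝ, ℝ)) (M × ℝ)) := fun hv =>
    (hFM.continuous_tangentMap le_rfl).comp hv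
  have hcontT : Continuous fun p : unitInterval × C => F (b p.2) := hcont.comp continuous_snd
  have hτ : Continuous fun p : unitInterval × C => (p.1 : ℝ) :=
    continuous_subtype_val.comp continuous_fst
  -- first homotopy: from the restriction of `ν` to `ν₀`
  obtain ⟨μ, hμc, hμ1, hμ2⟩ := exists_normalTriv_snoc (I := 𝓡 1)
    (J := (𝓡 (n + 1)).prod 𝓘(ℝ, ℝ)) (T := unitInterval) (g := F ∘ b)
    (fun t j x => V j x + (t : ℝ) • D x (u j x)) (fun _ x => D x (N x))
    (fun j => continuous_iff_continuousAt.2 fun p => ContinuousAt.bundle_add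
      ((hVc j).comp continuous_snd).continuousAt (ContinuousAt.bundle_smul hτ.continuousAt
        ((hDc (huc j)).comp continuous_snd).continuousAt))
    ((hDc hNc).comp continuous_snd) (by
      intro t x c c' v hv
      rw [hG] at hv
      -- Modulo `TW` the deformed fields equal the `V_j` and `N` vanishes, so independence of `ν`
      -- gives `c = 0`. The height component then gives `c' = 0`, as `TC` is horizontal.
      have h1 : ∑ j, c j • V j x = D x (mfderiv (𝓡 1) (𝓡∂ 2) b x v -
          ∑ j, c j • (t : ℝ) • u j x - c' • N x) := by
        have h3 : ∀ (A : EuclideanSpace ℝ (Fin 2) →L[ℝ] EuclideanSpace ℝ (Fin (n + 1)) × ℝ)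
            (v₀ w : EuclideanSpace ℝ (Fin 2)) (v₁ : Fin n → EuclideanSpace ℝ (Fin 2)),
            A (v₀ - ∑ j, c j • (t : ℝ) • v₁ j - c' • w) =
              A v₀ - ∑ j, c j • (t : ℝ) • A (v₁ j) - c' • A w := by
          intro A v₀ w v₁
          simp
        refine Eq.trans ?_ (h3 (D x) _ _ _).symm
        rw [hv]
        simp only [smul_add, Finset.sum_add_distrib]
        abel
      have h2 : c = 0 := funext (Fintype.linearIndependent_iff.1 (ν.linearIndependent (b x)) c (by
        simp only [← map_smul, ← map_sum]
        rw [Submodule.mkQ_apply, Submodule.Quotient.mk_eq_zero]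
        exact ⟨_, h1.symm⟩))
      refine ⟨h2, ?_⟩
      subst h2
      rw [← hG, hGι] at hv
      have h3 := congrArg Prod.snd hv
      simpa [hDN2] using h3.symm)
  -- second homotopy: from the normal field of the boundary to the unit field of `ℝ`
  obtain ⟨μ', hμc', hμ1', hμ2'⟩ := exists_normalTriv_snoc (I := 𝓡 1)
    (J := (𝓡 (n + 1)).prod 𝓘(ℝ, ℝ)) (T := unitInterval) (g := F ∘ b)
    (fun _ j x => V₀ j x) (fun t x => D x (N x) + (t : ℝ) • ∑ j, a x j • V₀ j x)
    (fun j => (hV₀c j).comp continuous_snd)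
    (continuous_iff_continuousAt.2 fun p => ContinuousAt.bundle_add
      ((hDc hNc).comp continuous_snd).continuousAt (ContinuousAt.bundle_smul hτ.continuousAt
        (ContinuousAt.bundle_sum _ hcontT.continuousAt fun j => ContinuousAt.bundle_smul
          ((continuous_apply j).comp (hac.comp continuous_snd)).continuousAt
          ((hV₀c j).comp continuous_snd).continuousAt))) (by
      intro t x c c' v hv
      rw [hGι] at hv
      -- Only the last field has nonzero height, equal to one throughout the homotopy; what remains
      -- is independence of `ν₀` modulo `TC`.
      have hc' : c' = 0 := by
        have h3 := congrArg Prod.snd hv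
        simpa [hDN2, V₀, Prod.snd_sum] using h3.symm
      subst hc'
      refine ⟨funext (Fintype.linearIndependent_iff.1 (ν₀.linearIndependent x) c (by
        simp only [← map_smul, ← map_sum]
        rw [Submodule.mkQ_apply, Submodule.Quotient.mk_eq_zero]
        refine ⟨v, ?_⟩
        have h3 := congrArg Prod.fst hv
        simp only [zero_smul, add_zero, V₀, Prod.fst_sum, Prod.smul_fst] at h3
        exact h3)), rfl⟩)
  have hμμ' : μ 1 = μ' 0 := by
    refine NormalTriv.ext_vec fun j x => ?_
    refine Fin.lastCases ?_ (fun j => ?_) j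
    · have h3 : D x (N x) = D x (N x) + ((0 : unitInterval) : ℝ) • ∑ j, a x j • V₀ j x := by simp
      exact ((hμ2 1 x).trans h3).trans (hμ2' 0 x).symm
    · have h3 : V j x + ((1 : unitInterval) : ℝ) • D x (u j x) = V₀ j x := by simp [hu']
      exact ((hμ1 1 j x).trans h3).trans (hμ1' 0 j x).symm
  have hrankG : Module.finrank ℝ (EuclideanSpace ℝ (Fin (n + 1)) × ℝ) =
      Module.finrank ℝ (EuclideanSpace ℝ (Fin 1)) + (n + 1) := finrank_prod_real 1 n
  have hqb : Continuous fun x => q (b x) := hq.comp hbM.continuous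
  have hec := σ.continuous_cylinderFrame hqb hcont fun x => hqF (b x)
  have heli : ∀ x, LinearIndependent ℝ fun i => σ.cylinderFrame (q (b x)) i := fun x =>
    σ.linearIndependent_cylinderFrame _
  obtain ⟨s, hs⟩ := (μ 0).exists_mapsTo (d := 1) hGM hGinj hrankG
    (e := fun i x => σ.cylinderFrame (q (b x)) i) hec heli
  obtain ⟨s₁, hs₁⟩ := (μ 1).exists_mapsTo (d := 1) hGM hGinj hrankG
    (e := fun i x => σ.cylinderFrame (q (b x)) i) hec heli
  have hss₁ : s.framing = s₁.framing := StableTriv.framing_eq_of_homotopic <|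
    NormalTriv.MapsTo.homotopic (e := fun _ i x => σ.cylinderFrame (q (b x)) i) hGM hGinj hrankG
      hμc (fun i => (hec i).comp continuous_snd) (fun _ => heli) hs hs₁
  refine ⟨N, s, hNc, fun x => ?_, fun i x => ?_, fun s₀ hs₀ => ?_⟩
  · have h1 := mfderiv_comp_apply (b x) (g := (Prod.snd : M × ℝ → ℝ)) (I' := (𝓡 (n + 1)).prod 𝓘(ℝ, ℝ))
      (I'' := 𝓘(ℝ, ℝ)) mdifferentiableAt_snd (hFM.mdifferentiable one_ne_zero (b x)) (N x)
    rw [mfderiv_snd] at h1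
    exact h1.trans (hDN2 x)
  -- At time zero the normal fields are the `V_j` and the image of `N`. Hence both sides of the
  -- restriction formula have the same vector of the cylinder frame as image, and the splitting of
  -- `ν` is injective.
  · refine ν.injective_splitting (hFinj (b x)) ((hψ i (b x)).trans ((hs i x).symm.trans ?_))
    refine ((μ 0).splitting_eq_of_snoc (fun j => hμ1 0 j x) (hμ2 0 x) (hG x _) _).trans ?_
    have h3 : ∀ (A : EuclideanSpace ℝ (Fin 2) →L[ℝ] EuclideanSpace ℝ (Fin (n + 1)) × ℝ)
        (v w : EuclideanSpace ℝ (Fin 2)) (v₁ : Fin n → EuclideanSpace ℝ (Fin 2))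
        (α : Fin (n + 1) → ℝ) (V : Fin n → EuclideanSpace ℝ (Fin (n + 1)) × ℝ),
        A v + (∑ j, α (Fin.castSucc j) • (V j + ((0 : unitInterval) : ℝ) • A (v₁ j)) +
          α (Fin.last n) • A w) =
          A (v + α (Fin.last n) • w) + ∑ j, α (Fin.castSucc j) • V j := by
      intro A v w v₁ α V
      simp
      abel
    exact h3 (D x) _ _ _ _ _
  -- At the end of the second homotopy the normal fields are the `V₀_j` and `∂_t`, so the situation
  -- is that of `ν₀` with a trivial summand added, which is stabilization of `s₀`.
  · have hs₂ : (μ' 1).MapsTo (s₀.stabilize (Nat.le_succ n))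
        (fun i x => σ.cylinderFrame (q (b x)) i) := by
      intro i x
      refine Fin.lastCases ?_ (fun i => ?_) i
      · have h1 : (s₀.stabilize (Nat.le_succ n)).vec (Fin.last (n + 1)) x =
            (0, Pi.single (Fin.last n) 1) := dif_neg (lt_irrefl (n + 1))
        rw [h1]
        refine ((μ' 1).splitting_eq_of_snoc (fun j => hμ1' 1 j x) (hμ2' 1 x) (hGι x _) _).trans
          (Eq.trans ?_ (σ.cylinderFrame_last (q (b x))).symm)
        rw [hDN]
        have h2 : @Eq (EuclideanSpace ℝ (Fin (n + 1)) × ℝ)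
            (mfderiv (𝓡 1) (𝓡 (n + 1)) ι x 0, 0) 0 :=
          congrArg (fun v : EuclideanSpace ℝ (Fin (n + 1)) => (v, (0 : ℝ))) (map_zero _)
        rw [h2]
        simp
      · have h1 : (s₀.stabilize (Nat.le_succ n)).vec (Fin.castSucc i) x =
            ((s₀.vec i x).1, fun k : Fin (n + 1) =>
              if hk : (k : ℕ) < n then (s₀.vec i x).2 ⟨k, hk⟩ else 0) :=
          dif_pos i.2
        rw [h1]
        refine ((μ' 1).splitting_eq_of_snoc (fun j => hμ1' 1 j x) (hμ2' 1 x) (hGι x _) _).trans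
          (Eq.trans ?_ (σ.cylinderFrame_castSucc (q (b x)) i).symm)
        have h2 : ∀ (w f : EuclideanSpace ℝ (Fin (n + 1))) (c : Fin n → ℝ)
            (V : Fin n → EuclideanSpace ℝ (Fin (n + 1))) (z : EuclideanSpace ℝ (Fin (n + 1)) × ℝ),
            w + ∑ j, c j • V j = f →
            (w, (0 : ℝ)) + (∑ j : Fin n, (if hk : ((Fin.castSucc j : Fin (n + 1)) : ℕ) < n then
              c ⟨((Fin.castSucc j : Fin (n + 1)) : ℕ), hk⟩ else 0) • ((V j, 0) :
                EuclideanSpace ℝ (Fin (n + 1)) × ℝ) +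
              (if hk : ((Fin.last n : Fin (n + 1)) : ℕ) < n then
              c ⟨((Fin.last n : Fin (n + 1)) : ℕ), hk⟩ else 0) • z) = (f, 0) := by
          rintro w _ c V z rfl
          ext <;> simp [Prod.fst_sum, Prod.snd_sum]
        exact h2 _ _ _ _ _ (hs₀ i x)
    rw [hss₁, ← s₀.framing_stabilize (Nat.le_succ n)]
    exact StableTriv.framing_eq_of_homotopic <|
      NormalTriv.MapsTo.homotopic (e := fun _ i x => σ.cylinderFrame (q (b x)) i) hGM hGinj hrankG
        hμc' (fun i => (hec i).comp continuous_snd) (fun _ => heli) (hμμ' ▸ hs₁) hs₂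

end

end BoundaryRestriction

/-! ### Bordism invariance and the degree map -/

section DegreeMap

variable {n : ℕ} {M : Type u} [TopologicalSpace M]
  [ChartedSpace (EuclideanSpace ℝ (Fin (n + 1))) M] [IsManifold (𝓡 (n + 1)) ∞ M]
  {o : TangentOrientation n M}

/-- A framed bordism in `M × [0, 1]` and a section of the spin structure over it give a stably
framed bordism of the induced stable framings. -/
theorem FramedBordant.stablyFramedBordant [Nonempty M] {σ : SpinStructure o}
    {X Y : NormallyFramedSubmanifold (n := n) M} (h : FramedBordant X Y)
    {Φ : StableFraming (𝓡 1) X.C.carrier 1} {Φ' : StableFraming (𝓡 1) Y.C.carrier 1}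
    (hΦ : IsInducedStableFraming σ X Φ) (hΦ' : IsInducedStableFraming σ Y Φ') :
    StablyFramedBordant ⟨X.C, Φ⟩ ⟨Y.C, Φ'⟩ := by
  obtain ⟨B, F, ν, hF, hF01, hF0, hF1, ⟨ν₀, hν₀, hν₀X⟩, ⟨ν₁, hν₁, hν₁Y⟩⟩ := h
  have hFM : ContMDiff (𝓡∂ 2) ((𝓡 (n + 1)).prod 𝓘(ℝ, ℝ)) 1 F := hF.contMDiff.of_le (by simp)
  obtain ⟨q, hq, hqF⟩ := σ.exists_section (hasSquareNhds_surface B.W) (g := fun w => (F w).1)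
    (continuous_fst.comp hFM.continuous)
  have hrank : Module.finrank ℝ (EuclideanSpace ℝ (Fin (n + 1)) × ℝ) =
      Module.finrank ℝ (EuclideanSpace ℝ (Fin 2)) + n := by
    rw [finrank_prod_real, finrank_euclideanSpace_fin, finrank_euclideanSpace_fin]
    ring
  obtain ⟨ψ, hψ⟩ := ν.exists_mapsTo (d := 2) hFM (hF.injective_mfderiv (by simp)) hrank
    (e := fun i w => σ.cylinderFrame (q w) i)
    (σ.continuous_cylinderFrame hq hFM.continuous hqF)
    fun w => σ.linearIndependent_cylinderFrame _
  have hheight : ∀ p, MDifferentiableAt (𝓡∂ 2) 𝓘(ℝ, ℝ) (fun w => (F w).2) p := fun p =>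
    mdifferentiableAt_snd.comp p (hFM.mdifferentiable one_ne_zero p)
  -- a stable framing obtained from a section over the bordism is the induced one
  have hind : ∀ (Z : NormallyFramedSubmanifold (n := n) M) (Ψ : StableFraming (𝓡 1) Z.C.carrier 1)
      (b : Z.C.carrier → B.W) (ν' : NormalTriv (𝓡 1) (𝓡 (n + 1)) Z.emb n) (t : ℝ),
      IsInducedStableFraming σ Z Ψ → ν'.framing = Z.framing → Continuous b →
      (∀ x, F (b x) = (Z.emb x, t)) → ∃ s : StableTriv (𝓡 1) Z.C.carrier 1 n,
        ν'.MapsTo s (fun i x => σ.frame (q (b x)) i) ∧ s.framing = Ψ := by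
    intro Z Ψ b ν' t hΨ hν' hb hFb
    have hqb : ∀ x, σ.base (q (b x)) = Z.emb x := fun x => by rw [hqF, hFb]
    obtain ⟨s, hs⟩ := ν'.exists_mapsTo (d := 1) Z.contMDiff Z.injective_mfderiv
      (finrank_euclidean_eq 1 n) (e := fun i x => σ.frame (q (b x)) i)
      (σ.continuous_frame (hq.comp hb) hqb) fun x => σ.linearIndependent_frame _
    refine ⟨s, hs, IsInducedStableFraming.unique ?_ hΨ⟩
    exact (isInducedStableFraming_iff σ Z _).2
      ⟨fun x => q (b x), ν', s, hq.comp hb, hqb, hν', rfl, hs⟩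
  obtain ⟨s₀, hs₀, hs₀Φ⟩ := hind X Φ B.b₀ ν₀ 0 hΦ hν₀X
    B.isSmoothEmbedding_b₀.contMDiff.continuous hF0
  obtain ⟨s₁, hs₁, hs₁Φ⟩ := hind Y Φ' B.b₁ ν₁ 1 hΦ' hν₁Y
    B.isSmoothEmbedding_b₁.contMDiff.continuous hF1
  obtain ⟨N₀, r₀, hN₀, hN₀1, hr₀, hr₀s⟩ := exists_isBoundaryRestriction σ
    X.isSmoothEmbedding_emb B.isSmoothEmbedding_b₀ hF hF0 hν₀ hq hqF hψ
  obtain ⟨N₁, r₁, hN₁, hN₁1, hr₁, hr₁s⟩ := exists_isBoundaryRestriction σ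
    Y.isSmoothEmbedding_emb B.isSmoothEmbedding_b₁ hF hF1 hν₁ hq hqF hψ
  -- Both transverse fields increase the height. The incoming end lies at its minimum `0` and the
  -- outgoing end at its maximum `1`, which gives the two opposite signs.
  refine ⟨B, n, ψ, ⟨N₀, r₀, hN₀, fun x => ?_, hr₀, (hr₀s s₀ hs₀).trans hs₀Φ⟩,
    ⟨N₁, r₁, hN₁, fun x => ?_, hr₁, (hr₁s s₁ hs₁).trans hs₁Φ⟩⟩
  · refine inwardComponent_pos (hheight _) (fun w => ?_) one_pos (hN₀1 x)
    rw [hF0]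
    exact (hF01 w).1
  · refine inwardComponent_neg (hheight _) (fun w => ?_) one_pos (hN₁1 x)
    rw [hF1]
    exact (hF01 w).2

/-- The degree map: the class of the induced stable framing, as a function of the framed bordism
class. -/
theorem exists_degreeMap [Nonempty M] (σ : SpinStructure o) :
    ∃ κ : OmegaOne (n := n) M → StableOmegaOne.{u},
      ∀ (X : NormallyFramedSubmanifold (n := n) M) (Φ : StableFraming (𝓡 1) X.C.carrier 1),
        IsInducedStableFraming σ X Φ → κ X.bordismClass = StableOmegaOne.mk X.C Φ := by
  choose Φ hΦ using exists_isInducedStableFraming (n := n) σ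
  refine ⟨Quot.lift (fun X => StableOmegaOne.mk X.C (Φ X)) fun X Y h =>
    Quot.sound (h.stablyFramedBordant (hΦ X) (hΦ Y)), fun X Ψ hΨ => ?_⟩
  rw [hΨ.unique (hΦ X)]
  rfl

end DegreeMap

theorem mainTheorem9 {n : ℕ} (hn : 3 ≤ n) {M : Type u} [TopologicalSpace M]
    [ChartedSpace (EuclideanSpace ℝ (Fin (n + 1))) M] [IsManifold (𝓡 (n + 1)) ∞ M]
    [CompactSpace M] [T2Space M] [ConnectedSpace M]
    (o : TangentOrientation n M) (σ : SpinStructure o) :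
    (∀ X : NormallyFramedSubmanifold (n := n) M, ∃! Φ, IsInducedStableFraming σ X Φ) ∧
    (∀ (X X' : NormallyFramedSubmanifold (n := n) M)
      (Φ : StableFraming (𝓡 1) X.C.carrier 1) (Φ' : StableFraming (𝓡 1) X'.C.carrier 1),
      IsInducedStableFraming σ X Φ → IsInducedStableFraming σ X' Φ' →
      X.bordismClass = X'.bordismClass →
      StableOmegaOne.mk X.C Φ = StableOmegaOne.mk X'.C Φ') ∧
    (∃! κ : OmegaOne (n := n) M → StableOmegaOne.{u},
      ∀ (X : NormallyFramedSubmanifold (n := n) M) (Φ : StableFraming (𝓡 1) X.C.carrier 1),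
        IsInducedStableFraming σ X Φ → κ X.bordismClass = StableOmegaOne.mk X.C Φ) := by
  have hM : Nonempty M := inferInstance
  obtain ⟨κ, hκ⟩ := exists_degreeMap (n := n) σ
  refine ⟨fun X => ?_, fun X X' Φ Φ' hΦ hΦ' h => ?_, κ, hκ, fun κ' hκ' => ?_⟩
  · obtain ⟨Φ, hΦ⟩ := exists_isInducedStableFraming σ X
    exact ⟨Φ, hΦ, fun Φ' hΦ' => hΦ'.unique hΦ⟩
  -- Equal classes mean equality in the quotient, possibly through a chain of bordisms, so the
  -- invariance is read off from the existence of `κ`.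
  · rw [← hκ X Φ hΦ, ← hκ X' Φ' hΦ', h]
  · funext c
    obtain ⟨X, rfl⟩ := Quot.exists_rep c
    obtain ⟨Φ, hΦ⟩ := exists_isInducedStableFraming σ X
    exact (hκ' X Φ hΦ).trans (hκ X Φ hΦ).symm
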